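/- Let $V$ be a finite set of $n\ge 3$ cities and let $c(\{u,v\})\ge 0$ be a length for each pair of cities. A tour is a cycle in the complete graph on $V$ that visits each city exactly once; its length is the sum of the lengths of its edges. The greedy algorithm starts with the empty edge set and in each iteration adds a cheapest new edge among those for which the resulting edge set is still contained in a tour (ties are broken arbitrarily); a greedy tour is any tour that can be its output. A partial greedy tour on $W\subseteq V$ is a path containing exactly the cities of $W$ that is contained in some greedy tour. For a class of instances, the approximation ratio $\rho(n)$ of the greedy algorithm is the supremum, over all instances of the class with $n$ cities and all greedy tours, of the length of the greedy tour divided by the length of a shortest tour. An instance is metric if $c(\{x,z\})\le c(\{x,y\})+c(\{y,z\})$ for any three cities; graphic if $c(\{u,v\})$ is the length of a shortest $u$-$v$ path in some connected unweighted undirected graph on the cities; an $L^p$ instance ($1\le p\le\infty$) if the cities are distinct points of the plane with $L^p$ distances; Euclidean if $p=2$; and rectilinear if $p=1$. For $k\ge 0$ let $n_k=3^{k+2}-1$ and let $V_k\subset\mathbb{Z}^2$ be the points of a $2\times\frac{3^{k+2}-1}{2}$ grid (2 rows), so that $|V_k|=n_k$. Let $G_k$ be any instance on $V_k$ such that (i)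 any two cities with the same x-coordinate or the same y-coordinate have their Euclidean distance as length, and (ii) the length for two cities that differ in both coordinates is at least the absolute difference of their x-coordinates. Theorem. 1. On metric, graphic, Euclidean and rectilinear instances, and on $L^p$ instances for every $p\in[1,\infty]$, the approximation ratio of the greedy algorithm is $\rho(n)=\Theta(\log n)$; that is, for each of these classes there are constants $a,b>0$ with $a\log n\le\rho(n)\le b\log n$ for all $n\ge 3$. 2. For every $k\ge 0$, conditions (i) and (ii) hold for the shortest path distances in the grid graph on $V_k$ (two points are adjacent if they are at distance 1) and for the $L^p$ distances on $V_k$, for every $p\in[1,\infty]$. Every $G_k$ has optimum tour length $n_k$, contains a partial greedy tour on all of $V_k$ of length exactly $(2k+8)\cdot 3^k-1$, and has a greedy tour of some length $\ell$ with $$\frac{\ell}{n_k}>\frac{(2k+8)\cdot 3^k-1}{3^{k+2}-1}\qquad\text{and}\qquad \frac{\ell}{n_k}\ge\frac29\log_3(n_k+1).$$ 3. Consequently, for every $k\ge 0$ and for each of the graphic, Euclidean, rectilinear and $L^p$ ($1\le p\le\infty$) classes, $\rho(n_k)\ge\frac29\log_3(n_k+1)$. -/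

import Mathlib

open scoped ENNReal

section Tours

variable {V : Type} [DecidableEq V]

/-- `T` is (the edge set of) a tour: a cycle in the complete graph on `V` that visits each
vertex exactly once. -/
def IsTour [Fintype V] (T : Finset (Sym2 V)) : Prop :=
  ∃ (v : V) (w : (⊤ : SimpleGraph V).Walk v v), w.IsHamiltonianCycle ∧ T = w.edges.toFinset

/-- The total length of a set of edges. -/
def edgeLength (c : Sym2 V → ℝ) (F : Finset (Sym2 V)) : ℝ :=
  ∑ e ∈ F, c e

/-- The edge set `F` forms a subgraph of some tour. -/
def ExtendsToTour [Fintype V] (F : Finset (Sym2 V)) : Prop :=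
  ∃ T : Finset (Sym2 V), IsTour T ∧ F ⊆ T

/-- The edge sets that can occur during a run of the greedy algorithm with edge lengths `c`:
start with no edge, and in each iteration add a cheapest new edge among those for which the
result is still a subgraph of a tour. Ties may be broken arbitrarily. -/
inductive GreedyReachable [Fintype V] (c : Sym2 V → ℝ) : Finset (Sym2 V) → Prop
  | empty : GreedyReachable c ∅
  | step (F : Finset (Sym2 V)) (e : Sym2 V) (hF : GreedyReachable c F)
      (he : e ∉ F) (hext : ExtendsToTour (insert e F))
      (hmin : ∀ e' : Sym2 V, e' ∉ F → ExtendsToTour (insert e' F) → c e ≤ c e') :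
      GreedyReachable c (insert e F)

/-- `T` is a greedy tour: a tour that can be the output of the greedy algorithm. -/
def IsGreedyTour [Fintype V] (c : Sym2 V → ℝ) (T : Finset (Sym2 V)) : Prop :=
  GreedyReachable c T ∧ IsTour T

/-- `S` is a tour of minimum length. -/
def IsShortestTour [Fintype V] (c : Sym2 V → ℝ) (S : Finset (Sym2 V)) : Prop :=
  IsTour S ∧ ∀ T : Finset (Sym2 V), IsTour T → edgeLength c S ≤ edgeLength c T

/-- The path `P` is a partial greedy tour on `W`: it contains exactly the vertices of `W`, and
some greedy tour contains it. -/
def IsPartialGreedyTour [Fintype V] (c : Sym2 V → ℝ) {u v : V}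
    (P : (⊤ : SimpleGraph V).Walk u v) (W : Set V) : Prop :=
  P.IsPath ∧ {x | x ∈ P.support} = W ∧
    ∃ T : Finset (Sym2 V), IsGreedyTour c T ∧ ∀ e ∈ P.edges, e ∈ T

end Tours

/-- A TSP instance: finitely many cities and a nonnegative length for each pair of cities.
The values of `cost` on the diagonal `s(v, v)` are irrelevant, as no tour uses them. -/
structure TSPInstance where
  City : Type
  [fintypeCity : Fintype City]
  [decEqCity : DecidableEq City]
  cost : Sym2 City → ℝ
  cost_nonneg : ∀ e, 0 ≤ cost e

attribute [instance] TSPInstance.fintypeCity TSPInstance.decEqCity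

/-- The worst-case approximation ratio of the greedy algorithm on the instances with `n` cities
from the class `C`: the supremum of the quotients of the length of a greedy tour and the
length of a shortest tour. -/
noncomputable def greedyRatio (C : TSPInstance → Prop) (n : ℕ) : ℝ≥0∞ :=
  ⨆ (I : TSPInstance) (_ : C I) (_ : Fintype.card I.City = n)
    (T : Finset (Sym2 I.City)) (_ : IsGreedyTour I.cost T)
    (S : Finset (Sym2 I.City)) (_ : IsShortestTour I.cost S),
      ENNReal.ofReal (edgeLength I.cost T) / ENNReal.ofReal (edgeLength I.cost S)

/-- `ρ n = Θ(log n)`, for numbers `n ≥ 3` of cities (there is no tour on fewer cities). -/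
def IsThetaLog (ρ : ℕ → ℝ≥0∞) : Prop :=
  ∃ a b : ℝ, 0 < a ∧ 0 < b ∧ ∀ n : ℕ, 3 ≤ n →
    ENNReal.ofReal (a * Real.log n) ≤ ρ n ∧ ρ n ≤ ENNReal.ofReal (b * Real.log n)

/-- Edge lengths given by the distances in the graph `G`. -/
noncomputable def graphCost {V : Type} (G : SimpleGraph V) : Sym2 V → ℝ :=
  Sym2.lift ⟨fun u v => (G.dist u v : ℝ), fun u v => congrArg Nat.cast (G.dist_comm (u := u) (v := v))⟩

/-- Edge lengths given by the `L^p` distances of points `x v` in the plane. -/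
noncomputable def pointCost {V : Type} (p : ℝ≥0∞) [Fact (1 ≤ p)]
    (x : V → PiLp p (fun _ : Fin 2 => ℝ)) : Sym2 V → ℝ :=
  Sym2.lift ⟨fun u v => dist (x u) (x v), fun u v => dist_comm (x u) (x v)⟩

/-- Metric instances: the triangle inequality holds for any three cities. -/
def IsMetricTSP (I : TSPInstance) : Prop :=
  ∀ x y z : I.City, x ≠ y → y ≠ z → x ≠ z →
    I.cost s(x, z) ≤ I.cost s(x, y) + I.cost s(y, z)

/-- Graphic instances: shortest path distances in a connected graph on the cities. -/
def IsGraphicTSP (I : TSPInstance) : Prop :=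
  ∃ G : SimpleGraph I.City, G.Connected ∧ I.cost = graphCost G

/-- Planar `L^p` instances: the cities are distinct points in the plane with `L^p` distances. -/
def IsLpTSP (p : ℝ≥0∞) [Fact (1 ≤ p)] (I : TSPInstance) : Prop :=
  ∃ x : I.City → PiLp p (fun _ : Fin 2 => ℝ), Function.Injective x ∧ I.cost = pointCost p x

/-- Euclidean instances. -/
def IsEuclideanTSP (I : TSPInstance) : Prop := IsLpTSP 2 I

/-- Rectilinear instances. -/
def IsRectilinearTSP (I : TSPInstance) : Prop := IsLpTSP 1 I

/-- The cities of the `k`-th grid instance: a `2 × ((3 ^ (k + 2) - 1) / 2)` grid. The first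
component is the x-coordinate, the second one is the y-coordinate. -/
abbrev GridCity (k : ℕ) : Type := Fin ((3 ^ (k + 2) - 1) / 2) × Fin 2

/-- The edge lengths `c` make the grid into an instance `G_k`. -/
structure IsGridInstance (k : ℕ) (c : Sym2 (GridCity k) → ℝ) : Prop where
  same_x : ∀ u v : GridCity k, u ≠ v → u.1 = v.1 → c s(u, v) = |((u.2 : ℕ) : ℝ) - ((v.2 : ℕ) : ℝ)|
  same_y : ∀ u v : GridCity k, u ≠ v → u.2 = v.2 → c s(u, v) = |((u.1 : ℕ) : ℝ) - ((v.1 : ℕ) : ℝ)|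
  diag : ∀ u v : GridCity k, u.1 ≠ v.1 → u.2 ≠ v.2 → |((u.1 : ℕ) : ℝ) - ((v.1 : ℕ) : ℝ)| ≤ c s(u, v)

/-- The grid points in the plane. -/
noncomputable def gridPoint (p : ℝ≥0∞) (k : ℕ) (u : GridCity k) : PiLp p (fun _ : Fin 2 => ℝ) :=
  WithLp.toLp p ![((u.1 : ℕ) : ℝ), ((u.2 : ℕ) : ℝ)]

/-- The grid graph: grid points at distance one are adjacent. -/
def gridGraph (k : ℕ) : SimpleGraph (GridCity k) :=
  SimpleGraph.pathGraph ((3 ^ (k + 2) - 1) / 2) □ SimpleGraph.pathGraph 2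

/-! Upper bound. Let `e` be an edge that the greedy algorithm adds to `F` when `m` edges are still
missing, and complete `F` to an oriented tour. If `(p, x)` and `(q, y)` are two of its edges outside
`F`, then replacing them by `xy` and `pq` (a 2-opt move) gives another tour containing `F`. Hence
`xy` was a candidate and is at least as long as `e` (`extends_insert_of_pairs`). So the `m` heads of
the missing edges have pairwise distance at least `c e`, and shortcutting a tour to these cities
shows that every tour has length at least `(m - 1) * c e` (`greedy_step_bound`). Summing over all
steps yields a harmonic sum, hence `O(log n)`.

Lower bound. `gridPath` is a recursive Hamiltonian path on the two-row grid: level `k + 1` consists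
of three copies of level `k` (one of them mirrored) and one extra column, joined by two unit steps
and two jumps of length `3 ^ (k + 1)`. Its length satisfies `L (k + 1) = 3 * L k + 2 * 3 ^ (k + 1) +
2`, so it exceeds the number of cities by a factor of order `k`, whereas the boundary tour has only
unit edges.

The path is greedy because each path edge of length `3 ^ j` with `j ≥ 1` joins top row points whose
x-coordinates are multiples of `3 ^ j` (`GridLink`). When such an edge is due, every other point
except the head of the path already has both of its path edges. Two distinct top row multiples of `3
^ j` are at least `3 ^ j` apart, so a cheaper non-path edge would have to join the head to such a
multiple. The x-distance then forces it to join the two ends of the initial segment `gridPath (j -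
1)`, which closes a short cycle (`IsAxisCost.not_extends_head`). Only distances along the axes and
the lower bound by the x-difference are used (`IsAxisCost`), so one argument serves all classes. For
general `n`, a tail of bottom row points is put in front of the path. -/

section TourLists

/-! ### Tours and paths as lists of cities -/

variable {V : Type}

/-- The pairs of consecutive entries of a list. -/
def pathPairs (l : List V) : List (V × V) := l.zip l.tail

/-- The pairs of cyclically consecutive entries of a list. -/
def tourPairs (l : List V) : List (V × V) := l.zip (l.rotate 1)

/-- The edges of the path that visits the entries of a list in order. -/
def pathEdges (l : List V) : List (Sym2 V) := (pathPairs l).map fun p => s(p.1, p.2)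

/-- The edges of the closed walk that visits the entries of a list in order. -/
def tourEdges [DecidableEq V] (l : List V) : Finset (Sym2 V) :=
  ((tourPairs l).map fun p => s(p.1, p.2)).toFinset

@[simp] lemma pathPairs_nil : pathPairs ([] : List V) = [] := rfl
@[simp] lemma pathPairs_singleton (a : V) : pathPairs [a] = [] := rfl
@[simp] lemma pathPairs_cons_cons (a b : V) (l : List V) :
    pathPairs (a :: b :: l) = (a, b) :: pathPairs (b :: l) := rfl

lemma pathPairs_append {A B : List V} (hA : A ≠ []) (hB : B ≠ []) :
    pathPairs (A ++ B) = pathPairs A ++ (A.getLast hA, B.head hB) :: pathPairs B := by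
  induction A with
  | nil => exact absurd rfl hA
  | cons a A ih =>
    cases A with
    | nil =>
      cases B with
      | nil => exact absurd rfl hB
      | cons b B => simp
    | cons a' A => simpa using ih (by simp)

lemma pathPairs_map {W : Type} (f : W → V) (l : List W) :
    pathPairs (l.map f) = (pathPairs l).map (Prod.map f f) := by
  rw [pathPairs, pathPairs, ← List.map_tail, List.zip_map]

lemma pathPairs_reverse (l : List V) :
    pathPairs l.reverse = ((pathPairs l).map Prod.swap).reverse := by
  induction l with
  | nil => rfl
  | cons a l ih =>
    cases l with
    | nil => rfl
    | cons b l =>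
      rw [List.reverse_cons, pathPairs_append (by simp) (by simp), ih]
      simp

lemma tourPairs_eq {l : List V} (h : l ≠ []) :
    tourPairs l = pathPairs l ++ [(l.getLast h, l.head h)] := by
  cases l with
  | nil => exact absurd rfl h
  | cons a l =>
    have h1 : tourPairs (a :: l) = pathPairs ((a :: l) ++ [a]) := by
      have : (a :: l).zip (l ++ [a]) = ((a :: l) ++ [a]).zip (l ++ [a]) := by
        conv_rhs => rw [show l ++ [a] = (l ++ [a]) ++ [] by simp]
        rw [List.zip_append (by simp)]
        simp
      simpa [tourPairs, pathPairs] using this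
    rw [h1, pathPairs_append (by simp) (by simp)]
    simp

lemma mem_pathPairs_iff {l : List V} {a b : V} :
    (a, b) ∈ pathPairs l ↔ ∃ (i : ℕ) (h : i + 1 < l.length), l[i] = a ∧ l[i + 1] = b := by
  simp only [pathPairs, List.mem_iff_getElem, List.getElem_zip, List.length_zip, List.length_tail,
    Prod.mk.injEq, List.getElem_tail]
  constructor
  · rintro ⟨i, h, h1, h2⟩
    exact ⟨i, by omega, h1, h2⟩
  · rintro ⟨i, h, h1, h2⟩
    exact ⟨i, by omega, h1, h2⟩

lemma mem_tourPairs_iff {l : List V} {a b : V} :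
    (a, b) ∈ tourPairs l ↔ ∃ (i : ℕ) (h : i < l.length),
      l[i] = a ∧ l[(i + 1) % l.length]'(Nat.mod_lt _ (by omega)) = b := by
  simp only [tourPairs, List.mem_iff_getElem, List.getElem_zip, List.length_zip,
    List.length_rotate, Prod.mk.injEq, List.getElem_rotate, min_self]

lemma pathPairs_subset_tourPairs {l : List V} : pathPairs l ⊆ tourPairs l := by
  rcases eq_or_ne l [] with rfl | h
  · simp
  · rw [tourPairs_eq h]; simp

lemma tourPairs_rotate (l : List V) (n : ℕ) : tourPairs (l.rotate n) = (tourPairs l).rotate n := by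
  unfold tourPairs
  rw [List.rotate_rotate, Nat.add_comm, ← List.rotate_rotate]
  exact (List.zipWith_rotate_distrib _ _ _ _ (by simp)).symm

lemma tourPairs_succ_unique {l : List V} (hl : l.Nodup) {a b c : V} (hb : (a, b) ∈ tourPairs l)
    (hc : (a, c) ∈ tourPairs l) : b = c := by
  obtain ⟨i, hi, h1, rfl⟩ := mem_tourPairs_iff.1 hb
  obtain ⟨j, hj, h2, rfl⟩ := mem_tourPairs_iff.1 hc
  obtain rfl : i = j := (hl.getElem_inj_iff).1 (h1.trans h2.symm)
  rfl

lemma tourPairs_pred_unique {l : List V} (hl : l.Nodup) {a b c : V} (hb : (b, a) ∈ tourPairs l)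
    (hc : (c, a) ∈ tourPairs l) : b = c := by
  obtain ⟨i, hi, rfl, h1⟩ := mem_tourPairs_iff.1 hb
  obtain ⟨j, hj, rfl, h2⟩ := mem_tourPairs_iff.1 hc
  have h : (i + 1) % l.length = (j + 1) % l.length :=
    (hl.getElem_inj_iff).1 (h1.trans h2.symm)
  have h' : i % l.length = j % l.length := Nat.ModEq.add_right_cancel' 1 h
  rw [Nat.mod_eq_of_lt hi, Nat.mod_eq_of_lt hj] at h'
  subst h'
  rfl

/-- Both orientations can occur only if going two steps around the cycle returns to the start.
Excluding this makes the passage from ordered pairs to unordered edges injective. -/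
lemma tourPairs_not_swap {l : List V} (hl : l.Nodup) (h3 : 3 ≤ l.length) {a b : V}
    (h : (a, b) ∈ tourPairs l) (h' : (b, a) ∈ tourPairs l) : False := by
  obtain ⟨i, hi, h1, h2⟩ := mem_tourPairs_iff.1 h
  obtain ⟨j, hj, h3, h4⟩ := mem_tourPairs_iff.1 h'
  have e1 : (i + 1) % l.length = j := (hl.getElem_inj_iff).1 (h2.trans h3.symm)
  have e2 : (j + 1) % l.length = i := (hl.getElem_inj_iff).1 (h4.trans h1.symm)
  rcases Nat.lt_or_ge (i + 1) l.length with hh | hh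
  · rw [Nat.mod_eq_of_lt hh] at e1
    rcases Nat.lt_or_ge (j + 1) l.length with hk | hk
    · rw [Nat.mod_eq_of_lt hk] at e2; omega
    · rw [show j + 1 = l.length by omega, Nat.mod_self] at e2; omega
  · rw [show i + 1 = l.length by omega, Nat.mod_self] at e1
    rw [← e1, Nat.mod_eq_of_lt (by omega)] at e2
    omega

lemma tourPairs_ne {l : List V} (hl : l.Nodup) (h3 : 3 ≤ l.length) {a b : V}
    (h : (a, b) ∈ tourPairs l) : a ≠ b := by
  rintro rfl
  exact tourPairs_not_swap hl h3 h h

lemma tourPairs_nodup {l : List V} (hl : l.Nodup) : (tourPairs l).Nodup :=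
  List.Nodup.of_map Prod.fst (by
    rw [tourPairs, List.map_fst_zip (by simp)]; exact hl)

lemma tourPairs_map_nodup {l : List V} (hl : l.Nodup) (h3 : 3 ≤ l.length) :
    ((tourPairs l).map fun p => s(p.1, p.2)).Nodup := by
  refine List.Nodup.map_on ?_ (tourPairs_nodup hl)
  rintro ⟨a, b⟩ h ⟨c, d⟩ h' e
  rcases Sym2.eq_iff.1 e with ⟨h1, h2⟩ | ⟨h1, h2⟩
  · simp_all
  · simp only at h1 h2
    subst h1 h2
    exact (tourPairs_not_swap hl h3 h h').elim

lemma mem_of_mem_tourPairs {l : List V} {a b : V} (h : (a, b) ∈ tourPairs l) : a ∈ l ∧ b ∈ l := by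
  obtain ⟨i, hi, rfl, rfl⟩ := mem_tourPairs_iff.1 h
  simp

lemma mem_pathEdges {l : List V} {a b : V} :
    s(a, b) ∈ pathEdges l ↔ (a, b) ∈ pathPairs l ∨ (b, a) ∈ pathPairs l := by
  simp only [pathEdges, List.mem_map, Prod.exists, Sym2.eq_iff]
  constructor
  · rintro ⟨c, d, h, ⟨rfl, rfl⟩ | ⟨rfl, rfl⟩⟩
    · exact Or.inl h
    · exact Or.inr h
  · rintro (h | h)
    · exact ⟨a, b, h, Or.inl ⟨rfl, rfl⟩⟩
    · exact ⟨b, a, h, Or.inr ⟨rfl, rfl⟩⟩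

lemma pathEdges_nodup {l : List V} (hl : l.Nodup) (h3 : 3 ≤ l.length) :
    (pathEdges l).Nodup := by
  have h : l ≠ [] := by rintro rfl; simp at h3
  have := tourPairs_map_nodup hl h3
  rw [tourPairs_eq h, List.map_append] at this
  exact this.of_append_left

lemma closing_notMem_pathEdges {l : List V} (hl : l.Nodup) (h3 : 3 ≤ l.length) (h : l ≠ []) :
    s(l.getLast h, l.head h) ∉ pathEdges l := by
  have := tourPairs_map_nodup hl h3
  rw [tourPairs_eq h, List.map_append, List.nodup_append] at this
  intro hm
  exact this.2.2 _ hm _ (by simp) rfl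

/-- The path in the complete graph along a list without repetitions. -/
lemma exists_walk_of_list {l : List V} (hl : l.Nodup) (h : l ≠ []) :
    ∃ P : (⊤ : SimpleGraph V).Walk (l.head h) (l.getLast h),
      P.IsPath ∧ P.support = l ∧ P.edges = pathEdges l := by
  have hc : l.IsChain (⊤ : SimpleGraph V).Adj := List.Pairwise.isChain (hl.imp fun h => by
    simpa using h)
  refine ⟨SimpleGraph.Walk.ofSupport l h hc, ?_, SimpleGraph.Walk.support_ofSupport h hc, ?_⟩
  · rw [SimpleGraph.Walk.isPath_def, SimpleGraph.Walk.support_ofSupport]; exact hl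
  · rw [SimpleGraph.Walk.edges_eq_zipWith_support, SimpleGraph.Walk.support_ofSupport, pathEdges,
      pathPairs, List.zip, List.map_zipWith]

variable [DecidableEq V]

lemma mem_tourEdges {l : List V} {a b : V} :
    s(a, b) ∈ tourEdges l ↔ (a, b) ∈ tourPairs l ∨ (b, a) ∈ tourPairs l := by
  simp only [tourEdges, List.mem_toFinset, List.mem_map, Prod.exists, Sym2.eq_iff]
  constructor
  · rintro ⟨c, d, h, ⟨rfl, rfl⟩ | ⟨rfl, rfl⟩⟩
    · exact Or.inl h
    · exact Or.inr h
  · rintro (h | h)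
    · exact ⟨a, b, h, Or.inl ⟨rfl, rfl⟩⟩
    · exact ⟨b, a, h, Or.inr ⟨rfl, rfl⟩⟩

lemma tourEdges_rotate (l : List V) (n : ℕ) : tourEdges (l.rotate n) = tourEdges l := by
  rw [tourEdges, tourPairs_rotate, List.map_rotate]
  exact List.toFinset_eq_of_perm _ _ (List.rotate_perm _ _)

lemma tourEdges_eq {l : List V} (h : l ≠ []) :
    tourEdges l = insert s(l.getLast h, l.head h) (pathEdges l).toFinset := by
  ext e
  simp [tourEdges, tourPairs_eq h, pathEdges]

lemma card_tourEdges {l : List V} (hl : l.Nodup) (h3 : 3 ≤ l.length) :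
    (tourEdges l).card = l.length := by
  rw [tourEdges, List.toFinset_card_of_nodup (tourPairs_map_nodup hl h3)]
  simp [tourPairs]

variable [Fintype V]

/-- The support of a Hamiltonian cycle repeats only its base point, so its tail is the list;
conversely, the path along the list is closed by one new edge. All later arguments use tours in this
form. -/
theorem isTour_iff {T : Finset (Sym2 V)} :
    IsTour T ↔ ∃ l : List V, l.Nodup ∧ (∀ v, v ∈ l) ∧ 3 ≤ l.length ∧ T = tourEdges l := by
  constructor
  · rintro ⟨v, w, hw, rfl⟩
    have hlen := hw.isCycle.three_le_length
    have hs : w.support = v :: w.support.tail := w.cons_tail_support.symm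
    have hne : w.support.tail ≠ [] := by
      intro h
      have := w.length_support
      rw [hs, h, List.length_singleton] at this
      omega
    refine ⟨w.support.tail, hw.isCycle.support_nodup, ?_, ?_, ?_⟩
    · intro x
      have := (SimpleGraph.Walk.isHamiltonianCycle_iff_isCycle_and_support_count_tail_eq_one.1 hw).2 x
      exact List.count_pos_iff.1 (by omega)
    · have := w.length_support
      rw [List.length_tail]; omega
    · have hlast : ∀ x, w.support.getLast? = some x → x = v := by
        intro x hx
        have := w.getLast_support
        rw [List.getLast?_eq_some_getLast w.support_ne_nil, this] at hx
        simpa using hx.symm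
      rw [tourEdges_eq hne, SimpleGraph.Walk.edges_eq_zipWith_support, pathEdges, pathPairs]
      generalize w.support = l at *
      obtain ⟨a, t, ht⟩ := List.exists_cons_of_ne_nil hne
      rw [ht] at hs
      subst hs
      have hl := hlast ((a :: t).getLast (by simp)) (by
        rw [List.getLast?_cons_cons, List.getLast?_eq_some_getLast (by simp)])
      ext e
      simp [hl, List.zip, List.map_zipWith]
  · rintro ⟨l, hl, hall, h3, rfl⟩
    have hne : l ≠ [] := by rintro rfl; simp at h3
    obtain ⟨P, hP, hsup, hed⟩ := exists_walk_of_list hl hne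
    have hcl := closing_notMem_pathEdges hl h3 hne
    have hadj : (⊤ : SimpleGraph V).Adj (l.getLast hne) (l.head hne) := by
      rw [SimpleGraph.top_adj]
      exact tourPairs_ne hl h3 (by rw [tourPairs_eq hne]; simp)
    refine ⟨_, SimpleGraph.Walk.cons hadj P, ?_, ?_⟩
    · rw [SimpleGraph.Walk.isHamiltonianCycle_iff_isCycle_and_support_count_tail_eq_one]
      refine ⟨(SimpleGraph.Walk.cons_isCycle_iff _ _).2 ⟨hP, by rwa [hed]⟩, fun a => ?_⟩
      simp [hsup, List.count_eq_one_of_mem hl (hall a)]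
    · rw [tourEdges_eq hne]
      simp [hed]

lemma length_eq_card {l : List V} (hl : l.Nodup) (hall : ∀ v, v ∈ l) :
    l.length = Fintype.card V := by
  rw [← List.toFinset_card_of_nodup hl, ← Finset.card_univ]
  congr 1
  ext v
  simp [hall v]

lemma IsTour.card_eq {T : Finset (Sym2 V)} (hT : IsTour T) : T.card = Fintype.card V := by
  obtain ⟨l, hl, hall, h3, rfl⟩ := isTour_iff.1 hT
  rw [card_tourEdges hl h3, length_eq_card hl hall]

lemma IsTour.ne {T : Finset (Sym2 V)} (hT : IsTour T) {a b : V} (h : s(a, b) ∈ T) : a ≠ b := by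
  obtain ⟨l, hl, hall, h3, rfl⟩ := isTour_iff.1 hT
  rcases mem_tourEdges.1 h with h | h
  · exact tourPairs_ne hl h3 h
  · exact (tourPairs_ne hl h3 h).symm

/-- A city of a tour has at most two neighbours. -/
lemma IsTour.not_three_neighbors {T : Finset (Sym2 V)} (hT : IsTour T) {a p q r : V}
    (hp : s(a, p) ∈ T) (hq : s(a, q) ∈ T) (hr : s(a, r) ∈ T) (hpq : p ≠ q) (hpr : p ≠ r)
    (hqr : q ≠ r) : False := by
  obtain ⟨l, hl, hall, h3, rfl⟩ := isTour_iff.1 hT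
  rcases mem_tourEdges.1 hp with hp | hp <;> rcases mem_tourEdges.1 hq with hq | hq <;>
    rcases mem_tourEdges.1 hr with hr | hr
  all_goals first
    | exact hpq (tourPairs_succ_unique hl hp hq)
    | exact hpq (tourPairs_pred_unique hl hp hq)
    | exact hpr (tourPairs_succ_unique hl hp hr)
    | exact hpr (tourPairs_pred_unique hl hp hr)
    | exact hqr (tourPairs_succ_unique hl hq hr)
    | exact hqr (tourPairs_pred_unique hl hq hr)

/-- A nonempty set of cities that no tour edge leaves contains all cities. -/
lemma IsTour.eq_univ_of_closed {T : Finset (Sym2 V)} (hT : IsTour T) {U : Set V} {x : V}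
    (hx : x ∈ U) (hU : ∀ a b, a ∈ U → s(a, b) ∈ T → b ∈ U) (y : V) : y ∈ U := by
  obtain ⟨l, hl, hall, h3, rfl⟩ := isTour_iff.1 hT
  obtain ⟨i, hi, rfl⟩ := List.mem_iff_getElem.1 (hall x)
  have key : ∀ d : ℕ, l[(i + d) % l.length]'(Nat.mod_lt _ (by omega)) ∈ U := by
    intro d
    induction d with
    | zero => simpa [Nat.mod_eq_of_lt hi] using hx
    | succ d ih =>
      refine hU _ _ ih (mem_tourEdges.2 (Or.inl (mem_tourPairs_iff.2
        ⟨(i + d) % l.length, Nat.mod_lt _ (by omega), rfl, ?_⟩)))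
      congr 1
      rw [Nat.mod_add_mod, Nat.add_assoc]
  obtain ⟨j, hj, rfl⟩ := List.mem_iff_getElem.1 (hall y)
  -- From index `i`, going `l.length - i` steps wraps around to index `0`, and `j` further steps
  -- reach `j`.
  have := key (j + (l.length - i))
  have e : (i + (j + (l.length - i))) % l.length = j := by
    rw [show i + (j + (l.length - i)) = j + l.length by omega, Nat.add_mod_right,
      Nat.mod_eq_of_lt hj]
  simpa [e] using this

lemma ExtendsToTour.mono {F G : Finset (Sym2 V)} (hG : ExtendsToTour G) (h : F ⊆ G) :
    ExtendsToTour F := by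
  obtain ⟨T, hT, hGT⟩ := hG
  exact ⟨T, hT, h.trans hGT⟩

lemma IsTour.extends {T : Finset (Sym2 V)} (hT : IsTour T) : ExtendsToTour T :=
  ⟨T, hT, subset_rfl⟩

end TourLists

/-! ### Path lengths and shortcutting -/

section PathLength

variable {V : Type}

/-- The total length of the path along a list, with respect to a distance function `d`. -/
def pathLength (d : V → V → ℝ) (l : List V) : ℝ := ((pathPairs l).map fun p => d p.1 p.2).sum

@[simp] lemma pathLength_singleton (d : V → V → ℝ) (a : V) : pathLength d [a] = 0 := by
  simp [pathLength]

@[simp] lemma pathLength_cons_cons (d : V → V → ℝ) (a b : V) (l : List V) :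
    pathLength d (a :: b :: l) = d a b + pathLength d (b :: l) := by
  simp [pathLength]

lemma pathLength_nonneg {d : V → V → ℝ} (h0 : ∀ x y, 0 ≤ d x y) (l : List V) :
    0 ≤ pathLength d l :=
  List.sum_nonneg (by
    simp only [List.mem_map]
    rintro _ ⟨p, -, rfl⟩
    exact h0 _ _)

lemma pathLength_le_cons {d : V → V → ℝ} (h0 : ∀ x y, 0 ≤ d x y) (a : V) (l : List V) :
    pathLength d l ≤ pathLength d (a :: l) := by
  cases l with
  | nil => simp [pathLength]
  | cons b l => simpa using h0 a b

/-- Keeping the first point `a` fixed lets the induction go through: deleting the point right after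
`a` is one use of the triangle inequality. -/
lemma pathLength_cons_le_of_sublist {d : V → V → ℝ} (h0 : ∀ x y, 0 ≤ d x y)
    (htri : ∀ x y z, d x z ≤ d x y + d y z) {l' l : List V} (h : l'.Sublist l) (a : V) :
    pathLength d (a :: l') ≤ pathLength d (a :: l) := by
  induction h generalizing a with
  | slnil => exact le_rfl
  | @cons l' l x h ih =>
    refine (ih a).trans ?_
    rw [pathLength_cons_cons]
    cases l with
    | nil => simpa using h0 a x
    | cons y l =>
      rw [pathLength_cons_cons, pathLength_cons_cons]
      linarith [htri a x y]
  | cons_cons x h ih =>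
    rw [pathLength_cons_cons, pathLength_cons_cons]
    linarith [ih x]

/-- Shortcutting a path does not make it longer. -/
lemma pathLength_le_of_sublist {d : V → V → ℝ} (h0 : ∀ x y, 0 ≤ d x y)
    (htri : ∀ x y z, d x z ≤ d x y + d y z) {l' l : List V} (h : l'.Sublist l) :
    pathLength d l' ≤ pathLength d l := by
  cases h with
  | slnil => exact le_rfl
  | @cons _ l x h =>
    exact (pathLength_le_cons h0 x l').trans (pathLength_cons_le_of_sublist h0 htri h x)
  | cons_cons x h => exact pathLength_cons_le_of_sublist h0 htri h x

lemma le_pathLength_of_pairwise {d : V → V → ℝ} {ℓ : ℝ} (hℓ : 0 ≤ ℓ) {l : List V}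
    (h : l.Pairwise fun x y => ℓ ≤ d x y) : ℓ * ((l.length : ℝ) - 1) ≤ pathLength d l := by
  induction l with
  | nil => simp [pathLength]; exact hℓ
  | cons a l ih =>
    cases l with
    | nil => simp
    | cons b l =>
      have h1 := ih h.of_cons
      have h2 : ℓ ≤ d a b := (List.pairwise_cons.1 h).1 b (by simp)
      rw [pathLength_cons_cons]
      simp only [List.length_cons, Nat.cast_add, Nat.cast_one] at h1 ⊢
      linarith

/-- A path through points of mutual distance at least `ℓ`. -/
lemma le_pathLength_of_separated [DecidableEq V] {d : V → V → ℝ} (h0 : ∀ x y, 0 ≤ d x y)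
    (htri : ∀ x y z, d x z ≤ d x y + d y z) {ℓ : ℝ} (hℓ : 0 ≤ ℓ) {X : Finset V}
    (hX : ∀ x ∈ X, ∀ y ∈ X, x ≠ y → ℓ ≤ d x y) {l : List V} (hl : l.Nodup)
    (hXl : ∀ x ∈ X, x ∈ l) : ℓ * ((X.card : ℝ) - 1) ≤ pathLength d l := by
  have hn : (l.filter (· ∈ X)).Nodup := hl.filter _
  have hcard : (l.filter (· ∈ X)).length = X.card := by
    rw [← List.toFinset_card_of_nodup hn]
    congr 1
    ext x
    simpa using hXl x
  rw [← hcard]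
  refine (le_pathLength_of_pairwise hℓ ?_).trans
    (pathLength_le_of_sublist h0 htri List.filter_sublist)
  refine List.Pairwise.imp_of_mem ?_ hn
  intro a b ha hb hab
  simp only [List.mem_filter, decide_eq_true_eq] at ha hb
  exact hX a ha.2 b hb.2 hab

end PathLength

/-! ### The logarithmic upper bound for metric instances -/

section MetricUpperBound

variable {V : Type} [DecidableEq V]

/-- The edge lengths as a distance function that vanishes on the diagonal. -/
def edgeDist (c : Sym2 V → ℝ) (x y : V) : ℝ := if x = y then 0 else c s(x, y)

lemma edgeDist_of_ne (c : Sym2 V → ℝ) {x y : V} (h : x ≠ y) : edgeDist c x y = c s(x, y) := by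
  simp [edgeDist, h]

lemma edgeDist_nonneg {c : Sym2 V → ℝ} (hc : ∀ e, 0 ≤ c e) (x y : V) : 0 ≤ edgeDist c x y := by
  unfold edgeDist
  split_ifs
  exacts [le_rfl, hc _]

/-- The metric condition concerns distinct cities only. The value zero on the diagonal extends it to
all triples, as shortcutting requires. -/
lemma edgeDist_triangle {c : Sym2 V → ℝ} (hc : ∀ e, 0 ≤ c e)
    (htri : ∀ x y z : V, x ≠ y → y ≠ z → x ≠ z → c s(x, z) ≤ c s(x, y) + c s(y, z))
    (x y z : V) : edgeDist c x z ≤ edgeDist c x y + edgeDist c y z := by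
  rcases eq_or_ne x z with rfl | hxz
  · have h1 := edgeDist_nonneg hc x y
    have h2 := edgeDist_nonneg hc y x
    have h3 : edgeDist c x x = 0 := by simp [edgeDist]
    linarith
  rcases eq_or_ne x y with rfl | hxy
  · simp [edgeDist]
  rcases eq_or_ne y z with rfl | hyz
  · simp [edgeDist]
  simpa [edgeDist, hxy, hyz, hxz] using htri x y z hxy hyz hxz

lemma pathLength_edgeDist (c : Sym2 V → ℝ) {l : List V} (hl : l.Nodup) (h3 : 3 ≤ l.length) :
    pathLength (edgeDist c) l = ((pathEdges l).map c).sum := by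
  rw [pathLength, pathEdges, List.map_map]
  congr 1
  refine List.map_congr_left ?_
  rintro ⟨a, b⟩ h
  exact edgeDist_of_ne c (tourPairs_ne hl h3 (pathPairs_subset_tourPairs h))

lemma edgeLength_tourEdges (c : Sym2 V → ℝ) {l : List V} (hl : l.Nodup) (h3 : 3 ≤ l.length)
    (hne : l ≠ []) : edgeLength c (tourEdges l) =
      pathLength (edgeDist c) l + c s(l.getLast hne, l.head hne) := by
  rw [edgeLength, tourEdges_eq hne, Finset.sum_insert (by
    simpa using closing_notMem_pathEdges hl h3 hne), List.sum_toFinset _ (pathEdges_nodup hl h3),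
    pathLength_edgeDist c hl h3, add_comm]

variable [Fintype V]

lemma IsTour.le_edgeLength_of_separated {c : Sym2 V → ℝ} (hc : ∀ e, 0 ≤ c e)
    (htri : ∀ x y z : V, x ≠ y → y ≠ z → x ≠ z → c s(x, z) ≤ c s(x, y) + c s(y, z))
    {S : Finset (Sym2 V)} (hS : IsTour S) {ℓ : ℝ} (hℓ : 0 ≤ ℓ) {X : Finset V}
    (hX : ∀ x ∈ X, ∀ y ∈ X, x ≠ y → ℓ ≤ c s(x, y)) :
    ℓ * ((X.card : ℝ) - 1) ≤ edgeLength c S := by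
  obtain ⟨l, hl, hall, h3, rfl⟩ := isTour_iff.1 hS
  have hne : l ≠ [] := by rintro rfl; simp at h3
  have := le_pathLength_of_separated (edgeDist_nonneg hc) (edgeDist_triangle hc htri) hℓ
    (fun x hx y hy hxy => by rw [edgeDist_of_ne c hxy]; exact hX x hx y hy hxy) hl
    (fun x _ => hall x)
  rw [edgeLength_tourEdges c hl h3 hne]
  linarith [hc s(l.getLast hne, l.head hne)]

/-- If two edges of a tour do not belong to `F`, then the second ends of these edges can be
joined: this is a 2-opt move. -/
lemma extends_insert_of_pairs {l : List V} (hl : l.Nodup) (hall : ∀ v, v ∈ l)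
    (h3 : 3 ≤ l.length) {F : Finset (Sym2 V)} (hF : F ⊆ tourEdges l) {p x q y : V}
    (hpx : (p, x) ∈ tourPairs l) (hqy : (q, y) ∈ tourPairs l) (hp : s(p, x) ∉ F)
    (hq : s(q, y) ∉ F) (hxy : x ≠ y) : s(x, y) ∉ F ∧ ExtendsToTour (insert s(x, y) F) := by
  constructor
  · intro h
    rcases mem_tourEdges.1 (hF h) with h' | h'
    · rw [tourPairs_pred_unique hl h' hqy] at h
      exact hq h
    · rw [tourPairs_pred_unique hl h' hpx, Sym2.eq_swap] at h
      exact hp h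
  · obtain ⟨i, hi, rfl⟩ := List.mem_iff_getElem.1 (hall x)
    -- Rotate the tour to start at `x` and split it just before `y`. The two pieces run from `x` to
    -- `q` and from `y` to `p`; the new tour traverses the first one backwards.
    obtain ⟨t, ht⟩ : ∃ t, l.rotate i = l[i] :: t := by
      refine ⟨l.drop (i + 1) ++ l.take i, ?_⟩
      rw [List.rotate_eq_drop_append_take hi.le, ← List.cons_getElem_drop_succ (h := hi)]
      rfl
    generalize l[i] = x at *
    have hl' : (x :: t).Nodup := ht ▸ List.nodup_rotate.2 hl
    have hall' : ∀ v, v ∈ x :: t := fun v => ht ▸ List.mem_rotate.2 (hall v)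
    have hlen : (x :: t).length = l.length := by rw [← ht, List.length_rotate]
    have hF' : F ⊆ tourEdges (x :: t) := by rwa [← ht, tourEdges_rotate]
    have hpair : ∀ z ∈ tourPairs l, z ∈ tourPairs (x :: t) := fun z hz => by
      rw [← ht, tourPairs_rotate]
      exact List.mem_rotate.2 hz
    replace hpx := hpair _ hpx
    replace hqy := hpair _ hqy
    obtain ⟨A, B, rfl⟩ : ∃ A B, t = A ++ y :: B :=
      List.append_of_mem (by simpa [hxy.symm] using hall' y)
    set L := x :: A with hL
    set M := y :: B with hM
    have hLM : x :: (A ++ M) = L ++ M := rfl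
    rw [hLM] at hl' hall' hlen hF' hpx hqy
    have hLne : L ≠ [] := by simp [hL]
    have hMne : M ≠ [] := by simp [hM]
    have hT := tourEdges_eq (l := L ++ M) (by simp [hLne])
    have hP : pathEdges (L ++ M) = pathEdges L ++ s(L.getLast hLne, y) :: pathEdges M := by
      rw [pathEdges, pathPairs_append hLne hMne]
      simp [pathEdges, hM]
    have hq' : L.getLast hLne = q := by
      refine tourPairs_pred_unique hl' (pathPairs_subset_tourPairs ?_) hqy
      rw [pathPairs_append hLne hMne]
      simp [hM]
    have hp' : M.getLast hMne = p := by
      refine tourPairs_pred_unique hl' ?_ hpx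
      rw [tourPairs_eq (by simp [hLne])]
      simp [hL, List.getLast_append_of_ne_nil, hMne]
    have hnod : (L.reverse ++ M).Nodup :=
      ((L.reverse_perm.append_right M).nodup_iff).2 hl'
    have hR : tourEdges (L.reverse ++ M) = _ := tourEdges_eq (by simp [hMne])
    have hP' : pathEdges (L.reverse ++ M) =
        pathEdges L.reverse ++ s(x, y) :: pathEdges M := by
      rw [pathEdges, pathPairs_append (by simp [hLne]) hMne]
      simp [pathEdges, hM, hL]
    -- Both pieces keep their edges, so only `px` and `qy` are lost, and neither belongs to `F`.
    have hrev : ∀ e, e ∈ pathEdges L.reverse ↔ e ∈ pathEdges L := by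
      intro e
      induction e with | _ a b
      rw [mem_pathEdges, mem_pathEdges, pathPairs_reverse]
      simp [or_comm]
    refine ⟨tourEdges (L.reverse ++ M), isTour_iff.2 ⟨_, hnod, fun v => ?_, ?_, rfl⟩, ?_⟩
    · simpa using hall' v
    · rw [← hlen] at h3
      simpa using h3
    · intro e he
      rw [hR, hP']
      rcases Finset.mem_insert.1 he with rfl | he
      · simp
      · have h1 := hF' he
        rw [hT, hP] at h1
        simp only [Finset.mem_insert, List.mem_toFinset, List.mem_append, List.mem_cons] at h1 ⊢
        rw [hrev]
        rcases h1 with rfl | h1 | rfl | h1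
        · exfalso
          apply hp
          simpa [hL, List.getLast_append_of_ne_nil, hMne, hp'] using he
        · exact Or.inr (Or.inl h1)
        · exact (hq (hq' ▸ he)).elim
        · exact Or.inr (Or.inr (Or.inr h1))

/-- The length of an edge that the greedy algorithm adds when `m` edges are still missing is at
most the minimum tour length divided by `max (m - 1) 1`. -/
lemma greedy_step_bound {c : Sym2 V → ℝ} (hc : ∀ e, 0 ≤ c e)
    (htri : ∀ x y z : V, x ≠ y → y ≠ z → x ≠ z → c s(x, z) ≤ c s(x, y) + c s(y, z))
    {S : Finset (Sym2 V)} (hS : IsTour S) {F : Finset (Sym2 V)} {e : Sym2 V} (he : e ∉ F)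
    (hext : ExtendsToTour (insert e F))
    (hmin : ∀ e' : Sym2 V, e' ∉ F → ExtendsToTour (insert e' F) → c e ≤ c e') :
    c e ≤ edgeLength c S * ((max (Fintype.card V - F.card - 1) 1 : ℕ) : ℝ)⁻¹ := by
  rw [← div_eq_mul_inv, le_div_iff₀ (by positivity)]
  -- With at most one missing edge the heads give nothing; the two ends of `e` itself serve as the
  -- separated set.
  rcases Nat.lt_or_ge (Fintype.card V - F.card - 1) 1 with hm | hm
  · rw [max_eq_right hm.le, Nat.cast_one, mul_one]
    induction e with | _ a b
    have hab : a ≠ b := by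
      obtain ⟨T, hT, h⟩ := hext
      exact hT.ne (h (Finset.mem_insert_self _ _))
    have := hS.le_edgeLength_of_separated hc htri (hc s(a, b)) (X := {a, b}) (by
      intro x hx y hy hxy
      simp only [Finset.mem_insert, Finset.mem_singleton] at hx hy
      rcases hx with rfl | rfl <;> rcases hy with rfl | rfl
      · exact (hxy rfl).elim
      · exact le_rfl
      · rw [Sym2.eq_swap]
      · exact (hxy rfl).elim)
    rw [Finset.card_pair hab] at this
    norm_num at this
    exact this
  · rw [max_eq_left hm]
    obtain ⟨T, hT, hFT⟩ := hext.mono (Finset.subset_insert e F)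
    have hcT := hT.card_eq
    obtain ⟨l, hl, hall, h3, rfl⟩ := isTour_iff.1 hT
    -- The missing edges, oriented along the tour. Their heads are distinct because each city is
    -- entered exactly once.
    set Q := (tourPairs l).filter fun p => s(p.1, p.2) ∉ F with hQ
    have hQn : (Q.map Prod.snd).Nodup := by
      refine List.Nodup.sublist (List.filter_sublist.map _) (l₂ := (tourPairs l).map Prod.snd) ?_
      rw [tourPairs, List.map_snd_zip (by simp)]
      exact List.nodup_rotate.2 hl
    have hlen : Q.length = Fintype.card V - F.card := by
      have hn : (Q.map fun p => s(p.1, p.2)).Nodup :=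
        (tourPairs_map_nodup hl h3).sublist (List.filter_sublist.map _)
      have h1 : (Q.map fun p => s(p.1, p.2)).toFinset = tourEdges l \ F := by
        ext e
        simp only [hQ, List.mem_toFinset, List.mem_map, List.mem_filter, Finset.mem_sdiff,
          tourEdges, decide_eq_true_eq]
        constructor
        · rintro ⟨p, ⟨hp, hp'⟩, rfl⟩
          exact ⟨⟨p, hp, rfl⟩, hp'⟩
        · rintro ⟨⟨p, hp, rfl⟩, hp'⟩
          exact ⟨p, ⟨hp, hp'⟩, rfl⟩
      have h2 := List.toFinset_card_of_nodup hn
      rw [h1, Finset.card_sdiff_of_subset hFT, hcT, List.length_map] at h2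
      exact h2.symm
    have := hS.le_edgeLength_of_separated hc htri (hc e) (X := (Q.map Prod.snd).toFinset) (by
      intro x hx y hy hxy
      simp only [hQ, List.mem_toFinset, List.mem_map, List.mem_filter, decide_eq_true_eq] at hx hy
      obtain ⟨⟨p, x⟩, ⟨hp, hp'⟩, rfl⟩ := hx
      obtain ⟨⟨q, y⟩, ⟨hq, hq'⟩, rfl⟩ := hy
      obtain ⟨h1, h2⟩ := extends_insert_of_pairs hl hall h3 hFT hp hq hp' hq' hxy
      exact hmin _ h1 h2)
    rw [List.toFinset_card_of_nodup hQn, List.length_map, hlen] at this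
    rwa [Nat.cast_sub (by omega), Nat.cast_one]

lemma GreedyReachable.edgeLength_le {c : Sym2 V → ℝ} (hc : ∀ e, 0 ≤ c e)
    (htri : ∀ x y z : V, x ≠ y → y ≠ z → x ≠ z → c s(x, z) ≤ c s(x, y) + c s(y, z))
    {S : Finset (Sym2 V)} (hS : IsTour S) {F : Finset (Sym2 V)} (hF : GreedyReachable c F) :
    edgeLength c F ≤ edgeLength c S *
      ∑ i ∈ Finset.range F.card, ((max (Fintype.card V - i - 1) 1 : ℕ) : ℝ)⁻¹ := by
  induction hF with
  | empty => simp [edgeLength]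
  | step F e hF he hext hmin ih =>
    rw [edgeLength, Finset.sum_insert he, Finset.card_insert_of_notMem he,
      Finset.sum_range_succ, mul_add, add_comm]
    exact add_le_add ih (greedy_step_bound hc htri hS he hext hmin)

/-- Read backwards, the sum is one plus the harmonic number of `n - 1`, so it is at most `2 + log
n`; the constant is absorbed since `log n ≥ 1` for `n ≥ 3`. -/
lemma sum_inv_max_le (n : ℕ) (hn : 3 ≤ n) :
    ∑ i ∈ Finset.range n, ((max (n - i - 1) 1 : ℕ) : ℝ)⁻¹ ≤ 3 * Real.log n := by
  obtain ⟨N, rfl⟩ : ∃ N, n = N + 1 := ⟨n - 1, by omega⟩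
  have h1 : ∑ i ∈ Finset.range (N + 1), ((max (N + 1 - i - 1) 1 : ℕ) : ℝ)⁻¹ =
      ∑ i ∈ Finset.range (N + 1), ((max i 1 : ℕ) : ℝ)⁻¹ := by
    rw [← Finset.sum_range_reflect]
    refine Finset.sum_congr rfl fun i hi => ?_
    have := Finset.mem_range.1 hi
    congr 3
    omega
  have h2 := harmonic_le_one_add_log N
  have h3 : ((harmonic N : ℚ) : ℝ) = ∑ i ∈ Finset.range N, ((max (i + 1) 1 : ℕ) : ℝ)⁻¹ := by
    simp [harmonic]
  rw [h1, Finset.sum_range_succ', ← h3]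
  have h4 : Real.log N ≤ Real.log (N + 1 : ℕ) := by
    refine Real.log_le_log (by norm_cast; omega) (by push_cast; linarith)
  have h5 : 1 ≤ Real.log (N + 1 : ℕ) := by
    rw [Real.le_log_iff_exp_le (by positivity)]
    have h6 : (3 : ℝ) ≤ (N + 1 : ℕ) := by exact_mod_cast hn
    linarith [Real.exp_one_lt_d9]
  simp only [zero_le, sup_of_le_right, Nat.cast_one, inv_one]
  linarith

end MetricUpperBound

theorem greedyRatio_metric_le (n : ℕ) (hn : 3 ≤ n) :
    greedyRatio IsMetricTSP n ≤ ENNReal.ofReal (3 * Real.log n) := by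
  refine iSup_le fun I => iSup_le fun hI => iSup_le fun hcard => iSup_le fun T => iSup_le fun hT =>
    iSup_le fun S => iSup_le fun hS => ENNReal.div_le_of_le_mul ?_
  have hlog : 0 ≤ Real.log n := Real.log_natCast_nonneg n
  rw [← ENNReal.ofReal_mul (by positivity)]
  refine ENNReal.ofReal_le_ofReal ?_
  have h1 := hT.1.edgeLength_le I.cost_nonneg hI hS.1
  rw [hT.2.card_eq, hcard] at h1
  have h0 : 0 ≤ edgeLength I.cost S := Finset.sum_nonneg fun e _ => I.cost_nonneg e
  have h2 := mul_le_mul_of_nonneg_left (sum_inv_max_le n hn) h0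
  linarith

lemma greedyRatio_mono {C D : TSPInstance → Prop} (h : ∀ I, C I → D I) (n : ℕ) :
    greedyRatio C n ≤ greedyRatio D n :=
  iSup_mono fun I => iSup_mono' fun hI => ⟨h I hI, le_rfl⟩

lemma IsGraphicTSP.isMetricTSP {I : TSPInstance} (h : IsGraphicTSP I) : IsMetricTSP I := by
  obtain ⟨G, hG, hc⟩ := h
  intro x y z _ _ _
  rw [hc]
  change (G.dist x z : ℝ) ≤ G.dist x y + G.dist y z
  exact_mod_cast hG.dist_triangle

lemma IsLpTSP.isMetricTSP {p : ℝ≥0∞} [Fact (1 ≤ p)] {I : TSPInstance} (h : IsLpTSP p I) :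
    IsMetricTSP I := by
  obtain ⟨f, hf, hc⟩ := h
  intro x y z _ _ _
  rw [hc]
  exact dist_triangle (f x) (f y) (f z)

/-! ### A criterion for greedy tours -/

section GreedyCriterion

variable {V : Type}

lemma pathPairs_infix {A B C : List V} {z : V × V} (h : z ∈ pathPairs B) :
    z ∈ pathPairs (A ++ B ++ C) := by
  have hB : B ≠ [] := by rintro rfl; simp at h
  have h1 : z ∈ pathPairs (A ++ B) := by
    rcases eq_or_ne A [] with rfl | hA
    · simpa
    · rw [pathPairs_append hA hB]; simp [h]
  rcases eq_or_ne C [] with rfl | hC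
  · simpa
  · rw [pathPairs_append (by simp [hB]) hC]; simp [h1]

/-- An interior entry of a list has two distinct neighbours. -/
lemma exists_neighbors_of_interior {l : List V} (hl : l.Nodup) (hne : l ≠ []) {v : V} (hv : v ∈ l)
    (hhead : v ≠ l.head hne) (hlast : v ≠ l.getLast hne) :
    ∃ p q, (p, v) ∈ pathPairs l ∧ (v, q) ∈ pathPairs l ∧ p ≠ q := by
  obtain ⟨i, hi, rfl⟩ := List.mem_iff_getElem.1 hv
  have h0 : i ≠ 0 := by
    rintro rfl
    exact hhead (List.head_eq_getElem hne).symm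
  have h1 : i + 1 < l.length := by
    by_contra h
    obtain rfl : i = l.length - 1 := by omega
    exact hlast (List.getLast_eq_getElem hne).symm
  refine ⟨l[i - 1], l[i + 1], mem_pathPairs_iff.2 ⟨i - 1, by omega, rfl, ?_⟩,
    mem_pathPairs_iff.2 ⟨i, h1, rfl, rfl⟩, ?_⟩
  · congr 1; omega
  · rw [Ne, hl.getElem_inj_iff]; omega

variable [DecidableEq V] [Fintype V]

/-- A Hamiltonian path can be extended to a tour in only one way. -/
lemma eq_closing_of_extends {l : List V} (hl : l.Nodup) (hall : ∀ v, v ∈ l)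
    (hne : l ≠ []) {f : Sym2 V} (hf : f ∉ pathEdges l)
    (hext : ExtendsToTour (insert f (pathEdges l).toFinset)) :
    f = s(l.getLast hne, l.head hne) := by
  obtain ⟨T, hT, hFT⟩ := hext
  have hP : ∀ {a b : V}, (a, b) ∈ pathPairs l → s(a, b) ∈ T := fun h =>
    hFT (Finset.mem_insert_of_mem (List.mem_toFinset.2 (mem_pathEdges.2 (Or.inl h))))
  -- An interior city already has two path neighbours, so `f` would be a third tour edge there.
  have key : ∀ a b : V, f = s(a, b) → a = l.head hne ∨ a = l.getLast hne := by
    intro a b hfab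
    by_contra! h
    obtain ⟨p, q, hp, hq, hpq⟩ := exists_neighbors_of_interior hl hne (hall a) h.1 h.2
    have hab : s(a, b) ∈ T := hfab ▸ hFT (Finset.mem_insert_self _ _)
    rw [hfab] at hf
    refine hT.not_three_neighbors (by rw [Sym2.eq_swap]; exact hP hp) (hP hq) hab hpq ?_ ?_
    · rintro rfl; exact hf (mem_pathEdges.2 (Or.inr hp))
    · rintro rfl; exact hf (mem_pathEdges.2 (Or.inl hq))
  induction f with | _ a b
  have hab : a ≠ b := hT.ne (hFT (Finset.mem_insert_self _ _))
  rcases key a b rfl with ha | ha <;> rcases key b a Sym2.eq_swap with hb | hb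
  · exact (hab (ha.trans hb.symm)).elim
  · rw [ha, hb, Sym2.eq_swap]
  · rw [ha, hb]
  · exact (hab (ha.trans hb.symm)).elim

/-- A sufficient condition for a tour to be a greedy tour, in terms of a Hamiltonian path: each
edge outside the path that is cheaper than some path edge `e` conflicts with the path edges
cheaper than `e`. -/
theorem isGreedyTour_tourEdges {c : Sym2 V → ℝ} {l : List V} (hl : l.Nodup) (hall : ∀ v, v ∈ l)
    (h3 : 3 ≤ l.length)
    (H : ∀ e ∈ pathEdges l, ∀ f ∉ pathEdges l, c f < c e →
      ¬ ExtendsToTour (insert f ((pathEdges l).toFinset.filter fun e' => c e' < c e))) :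
    IsGreedyTour c (tourEdges l) := by
  have hne : l ≠ [] := by rintro rfl; simp at h3
  have hTour : IsTour (tourEdges l) := isTour_iff.2 ⟨l, hl, hall, h3, rfl⟩
  have hPT : (pathEdges l).toFinset ⊆ tourEdges l := by
    rw [tourEdges_eq hne]; exact Finset.subset_insert _ _
  set P := (pathEdges l).toFinset with hPdef
  have hmem : ∀ e, e ∈ pathEdges l ↔ e ∈ P := fun e => by rw [hPdef, List.mem_toFinset]
  -- The run adds the path edges in order of length. With `e` a cheapest path edge not in `F`, all
  -- path edges cheaper than `e` are in `F`, so `H` rules out every cheaper candidate outside the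
  -- path.
  have key : ∀ k ≤ P.card, ∃ F ⊆ P, F.card = k ∧ GreedyReachable c F := by
    intro k
    induction k with
    | zero => exact fun _ => ⟨∅, by simp, rfl, .empty⟩
    | succ k ih =>
      intro hk
      obtain ⟨F, hFP, hFk, hF⟩ := ih (by omega)
      obtain ⟨e, he, hmin⟩ := Finset.exists_min_image (P \ F) c (by
        rw [← Finset.card_pos, Finset.card_sdiff_of_subset hFP]; omega)
      rw [Finset.mem_sdiff] at he
      have hins : insert e F ⊆ P := Finset.insert_subset he.1 hFP
      refine ⟨insert e F, hins, by rw [Finset.card_insert_of_notMem he.2, hFk],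
        .step F e hF he.2 ⟨_, hTour, hins.trans hPT⟩ fun f hfF hfext => ?_⟩
      by_contra! hlt
      by_cases hfP : f ∈ P
      · exact absurd (hmin f (Finset.mem_sdiff.2 ⟨hfP, hfF⟩)) (not_le.2 hlt)
      · refine H e ((hmem e).2 he.1) f (fun h => hfP ((hmem f).1 h)) hlt
          (hfext.mono (Finset.insert_subset_insert f fun e' he' => ?_))
        rw [Finset.mem_filter] at he'
        by_contra hF'
        exact absurd (hmin e' (Finset.mem_sdiff.2 ⟨he'.1, hF'⟩)) (not_le.2 he'.2)
  obtain ⟨F, hFP, hFk, hF⟩ := key _ le_rfl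
  obtain rfl := Finset.eq_of_subset_of_card_le hFP hFk.ge
  refine ⟨?_, hTour⟩
  rw [tourEdges_eq hne]
  -- The last step has a single candidate, so the length of the closing edge does not matter.
  refine .step _ _ hF ?_ ?_ fun f hf hfext => ?_
  · rw [← hmem]; exact closing_notMem_pathEdges hl h3 hne
  · rw [← hPdef, ← tourEdges_eq hne]; exact hTour.extends
  · rw [eq_closing_of_extends hl hall hne (fun h => hf ((hmem f).1 h)) hfext]

lemma exists_isShortestTour (c : Sym2 V → ℝ) {T : Finset (Sym2 V)} (hT : IsTour T) :
    ∃ S, IsShortestTour c S := by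
  classical
  obtain ⟨S, hS, hmin⟩ := Finset.exists_min_image (Finset.univ.filter fun T => IsTour T)
    (edgeLength c) ⟨T, by simpa using hT⟩
  exact ⟨S, by simpa using hS, fun T hT => hmin T (by simpa using hT)⟩

end GreedyCriterion

/-- Any tour `S` may replace a shortest one in the denominator, as this only weakens the bound.
Positivity of the greedy length excludes the quotient `0 / 0`, which is zero by convention. -/
lemma le_greedyRatio {C : TSPInstance → Prop} {n : ℕ} {I : TSPInstance} (hI : C I)
    (hcard : Fintype.card I.City = n) {T S : Finset (Sym2 I.City)} (hT : IsGreedyTour I.cost T)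
    (hS : IsTour S) {r : ℝ} (hr : 0 ≤ r) (hpos : 0 < edgeLength I.cost T)
    (h : r * edgeLength I.cost S ≤ edgeLength I.cost T) :
    ENNReal.ofReal r ≤ greedyRatio C n := by
  obtain ⟨S', hS'⟩ := exists_isShortestTour I.cost hS
  refine le_trans ?_ (le_iSup_of_le I <| le_iSup_of_le hI <| le_iSup_of_le hcard <|
    le_iSup_of_le T <| le_iSup_of_le hT <| le_iSup_of_le S' <| le_iSup_of_le hS' le_rfl)
  rw [ENNReal.le_div_iff_mul_le (Or.inr (by simpa using hpos)) (Or.inl ENNReal.ofReal_ne_top),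
    ← ENNReal.ofReal_mul hr]
  exact ENNReal.ofReal_le_ofReal
    ((mul_le_mul_of_nonneg_left (hS'.2 S hS) hr).trans h)

/-! ### Lengths of concatenated, mapped and reversed paths -/

section PathLengthAppend

variable {V W : Type}

lemma pathLength_append {d : V → V → ℝ} {A B : List V} {a b : V} (hA : A.getLast? = some a)
    (hB : B.head? = some b) :
    pathLength d (A ++ B) = pathLength d A + d a b + pathLength d B := by
  have hA' : A ≠ [] := by rintro rfl; simp at hA
  have hB' : B ≠ [] := by rintro rfl; simp at hB
  rw [List.getLast?_eq_some_getLast hA', Option.some_inj] at hA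
  rw [List.head?_eq_some_head hB', Option.some_inj] at hB
  rw [pathLength, pathPairs_append hA' hB', hA, hB]
  simp [pathLength, add_assoc]

lemma pathLength_map {d : V → V → ℝ} {d' : W → W → ℝ} {f : W → V}
    (h : ∀ x y, d (f x) (f y) = d' x y) (l : List W) :
    pathLength d (l.map f) = pathLength d' l := by
  rw [pathLength, pathPairs_map, List.map_map, pathLength]
  congr 1
  exact List.map_congr_left fun p _ => h p.1 p.2

lemma pathLength_reverse {d : V → V → ℝ} (h : ∀ x y, d x y = d y x) (l : List V) :
    pathLength d l.reverse = pathLength d l := by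
  rw [pathLength, pathPairs_reverse, List.map_reverse, List.sum_reverse, List.map_map, pathLength]
  congr 1
  exact List.map_congr_left fun p _ => h p.2 p.1

lemma rel_of_mem_pathPairs {R : V → V → Prop} {l : List V} (h : l.IsChain R) {a b : V}
    (hab : (a, b) ∈ pathPairs l) : R a b := by
  obtain ⟨i, hi, rfl, rfl⟩ := mem_pathPairs_iff.1 hab
  exact List.isChain_iff_getElem.1 h i hi

end PathLengthAppend

/-! ### The recursive grid path -/

section GridPath

/-- The Hamiltonian path that the greedy algorithm finds on the points with x-coordinates
`1, …, (3 ^ (k + 2) - 1) / 2` and y-coordinates `0, 1`. It consists of a copy of the previous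
path, a mirrored copy and a shifted copy, and one more column. -/
def gridPath : ℕ → List (ℤ × ℤ)
  | 0 => [(1, 0), (1, 1), (2, 1), (2, 0), (3, 0), (4, 0), (4, 1), (3, 1)]
  | k + 1 => gridPath k ++ (((gridPath k).map fun p => (3 ^ (k + 2) - p.1, p.2)).reverse ++
      ((3 ^ (k + 2), 0) :: ((gridPath k).map (fun p => (3 ^ (k + 2) + p.1, p.2)) ++
        [(3 ^ (k + 2), 1)])))

lemma head?_gridPath (k : ℕ) : (gridPath k).head? = some (1, 0) := by
  induction k with
  | zero => rfl
  | succ k ih => simp [gridPath, ih]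

lemma getLast?_gridPath (k : ℕ) : (gridPath k).getLast? = some (3 ^ (k + 1), 1) := by
  induction k with
  | zero => rfl
  | succ k ih =>
    simp only [gridPath, ← List.cons_append, ← List.append_assoc]
    rw [List.getLast?_concat]

/-- With `C = 3 ^ (k + 2)`, which is odd, the first copy fills columns `1` to `(C - 1) / 2`, the
mirrored copy fills `(C + 1) / 2` to `C - 1`, column `C` is extra, and the shifted copy fills `C +
1` to `(3 * C - 1) / 2`. -/
lemma mem_gridPath {k : ℕ} {p : ℤ × ℤ} : p ∈ gridPath k ↔
    1 ≤ p.1 ∧ 2 * p.1 + 1 ≤ 3 ^ (k + 2) ∧ (p.2 = 0 ∨ p.2 = 1) := by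
  induction k generalizing p with
  | zero =>
    obtain ⟨x, y⟩ := p
    simp only [gridPath, List.mem_cons, Prod.mk.injEq, List.not_mem_nil, or_false]
    constructor
    · intro h
      norm_num
      omega
    · intro h
      norm_num at h
      omega
  | succ k ih =>
    obtain ⟨x, y⟩ := p
    simp only [gridPath, List.mem_append, List.mem_reverse, List.mem_cons, List.mem_map,
      ih, List.not_mem_nil, or_false, Prod.mk.injEq, Prod.exists]
    have h3 : (3 : ℤ) ^ (k + 1 + 2) = 3 * 3 ^ (k + 2) := by ring
    rw [h3]
    have hodd : ∃ w : ℤ, (3 : ℤ) ^ (k + 2) = 2 * w + 1 := (Odd.pow (by decide))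
    have hpos : (9 : ℤ) ≤ 3 ^ (k + 2) := by
      have : (1 : ℤ) ≤ 3 ^ k := one_le_pow₀ (by norm_num)
      rw [pow_add]; linarith
    generalize (3 : ℤ) ^ (k + 2) = C at *
    constructor
    · rintro (h | ⟨a, b, h, h1, h2⟩ | h | ⟨a, b, h, h1, h2⟩ | h) <;> omega
    · intro h
      obtain ⟨w, hw⟩ := hodd
      by_cases h1 : 2 * x + 1 ≤ C
      · exact Or.inl ⟨h.1, h1, h.2.2⟩
      by_cases h2 : x < C
      · exact Or.inr (Or.inl ⟨C - x, y, ⟨by omega, by omega, h.2.2⟩, by omega, rfl⟩)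
      by_cases h4 : C < x
      · exact Or.inr (Or.inr (Or.inr (Or.inl
          ⟨x - C, y, ⟨by omega, by omega, h.2.2⟩, by omega, rfl⟩)))
      have h5 : x = C := by omega
      rcases h.2.2 with h6 | h6
      · exact Or.inr (Or.inr (Or.inl ⟨h5, h6⟩))
      · exact Or.inr (Or.inr (Or.inr (Or.inr ⟨h5, h6⟩)))

lemma gridPath_nodup (k : ℕ) : (gridPath k).Nodup := by
  induction k with
  | zero => decide
  | succ k ih =>
    have hpos : (9 : ℤ) ≤ 3 ^ (k + 2) := by
      have : (1 : ℤ) ≤ 3 ^ k := one_le_pow₀ (by norm_num)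
      rw [pow_add]; linarith
    have hm : ∀ p, p ∈ gridPath k ↔ _ := fun p => mem_gridPath
    rw [gridPath]
    generalize (3 : ℤ) ^ (k + 2) = C at *
    simp only [List.nodup_append, List.nodup_cons, List.nodup_reverse, List.mem_append,
      List.mem_reverse, List.mem_cons, List.mem_map, List.not_mem_nil, or_false, hm]
    have h1 : (List.map (fun p : ℤ × ℤ => (C - p.1, p.2)) (gridPath k)).Nodup :=
      ih.map fun p q h => by
        simp only [Prod.mk.injEq] at h
        exact Prod.ext (by omega) h.2
    have h2 : (List.map (fun p : ℤ × ℤ => (C + p.1, p.2)) (gridPath k)).Nodup :=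
      ih.map fun p q h => by
        simp only [Prod.mk.injEq] at h
        exact Prod.ext (by omega) h.2
    refine ⟨ih, ⟨h1, ⟨?_, h2, by simp, ?_⟩, ?_⟩, ?_⟩
    · rintro (⟨p, hp, h⟩ | h)
      · simp only [Prod.mk.injEq] at h; omega
      · simp at h
    · rintro _ ⟨p, hp, rfl⟩ _ rfl h
      simp only [Prod.mk.injEq] at h; omega
    · rintro _ ⟨p, hp, rfl⟩ _ (rfl | ⟨q, hq, rfl⟩ | rfl) h <;>
        simp only [Prod.mk.injEq] at h <;> omega
    · rintro _ hp _ (⟨q, hq, rfl⟩ | rfl | ⟨q, hq, rfl⟩ | rfl) rfl <;>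
        simp only at hp <;> omega

lemma length_gridPath (k : ℕ) : (gridPath k).length + 1 = 3 ^ (k + 2) := by
  induction k with
  | zero => rfl
  | succ k ih =>
    have : 3 ^ (k + 1 + 2) = 3 * 3 ^ (k + 2) := by ring
    simp only [gridPath, List.length_append, List.length_reverse, List.length_map,
      List.length_cons, List.length_nil]
    omega

/-- The lower levels are the segments in which a premature edge at the head of the path would close
a cycle. -/
lemma gridPath_prefix {i k : ℕ} (h : i ≤ k) : ∃ B, gridPath k = gridPath i ++ B := by
  induction h with
  | refl => exact ⟨[], by simp⟩
  | @step k h ih =>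
    obtain ⟨B, hB⟩ := ih
    rw [gridPath, hB, List.append_assoc]
    exact ⟨_, rfl⟩

/-- The rectilinear distance of grid points. -/
def taxiDist (p q : ℤ × ℤ) : ℝ := ((|p.1 - q.1| + |p.2 - q.2| : ℤ) : ℝ)

lemma taxiDist_comm (p q : ℤ × ℤ) : taxiDist p q = taxiDist q p := by
  unfold taxiDist
  rw [abs_sub_comm p.1, abs_sub_comm p.2]

lemma pathLength_gridPath (k : ℕ) :
    pathLength taxiDist (gridPath k) = (2 * (k : ℝ) + 8) * 3 ^ k - 1 := by
  induction k with
  | zero =>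
    norm_num [gridPath, taxiDist]
  | succ k ih =>
    have hh := head?_gridPath k
    have hl := getLast?_gridPath k
    rw [gridPath, pathLength_append hl (b := (3 ^ (k + 2) - 3 ^ (k + 1), 1)),
      pathLength_append (a := (3 ^ (k + 2) - 1, 0)) (b := (3 ^ (k + 2), 0)) _ rfl,
      ← List.singleton_append,
      pathLength_append (a := (3 ^ (k + 2), 0)) rfl (b := (3 ^ (k + 2) + 1, 0)),
      pathLength_append (a := (3 ^ (k + 2) + 3 ^ (k + 1), 1)) _ rfl,
      pathLength_reverse taxiDist_comm, pathLength_map (d' := taxiDist),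
      pathLength_map (d' := taxiDist), ih]
    · have h1 : taxiDist (3 ^ (k + 1), 1) (3 ^ (k + 2) - 3 ^ (k + 1), 1) = 3 ^ (k + 1) := by
        have : (3 : ℤ) ^ (k + 1) - (3 ^ (k + 2) - 3 ^ (k + 1)) = - 3 ^ (k + 1) := by ring
        simp [taxiDist, this]
      have h2 : taxiDist (3 ^ (k + 2) - 1, 0) (3 ^ (k + 2), 0) = 1 := by simp [taxiDist]
      have h3 : taxiDist (3 ^ (k + 2), 0) (3 ^ (k + 2) + 1, 0) = 1 := by simp [taxiDist]
      have h4 : taxiDist (3 ^ (k + 2) + 3 ^ (k + 1), 1) (3 ^ (k + 2), 1) = 3 ^ (k + 1) := by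
        simp [taxiDist]
      rw [h1, h2, h3, h4]
      simp only [pathLength_singleton]
      push_cast
      ring
    · intro p q
      simp [taxiDist]
    · intro p q
      simp only [taxiDist, sub_sub_sub_cancel_left]
      rw [abs_sub_comm]
    · simp [List.getLast?_map, hl]
    · simp [List.head?_append, List.head?_map, hh]
    · simp [List.getLast?_reverse, List.head?_map, hh]
    · simp [List.head?_append, List.getLast?_map, hl]

/-- The relation between consecutive points of a grid path: they are at distance one, or in the
top row at distance `3 ^ i` with x-coordinates divisible by `3 ^ i`. -/
def GridLink (k : ℕ) (p q : ℤ × ℤ) : Prop :=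
  (p.1 = q.1 ∧ |p.2 - q.2| = 1) ∨ (p.2 = q.2 ∧ |p.1 - q.1| = 1) ∨
    (p.2 = 1 ∧ q.2 = 1 ∧ ∃ i ≤ k, |p.1 - q.1| = 3 ^ i ∧ (3 : ℤ) ^ i ∣ p.1 ∧ (3 : ℤ) ^ i ∣ q.1)

lemma GridLink.symm {k : ℕ} {p q : ℤ × ℤ} (h : GridLink k p q) : GridLink k q p := by
  rcases h with ⟨h1, h2⟩ | ⟨h1, h2⟩ | ⟨h1, h2, i, hi, h3, h4, h5⟩
  · exact Or.inl ⟨h1.symm, by rwa [abs_sub_comm]⟩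
  · exact Or.inr (Or.inl ⟨h1.symm, by rwa [abs_sub_comm]⟩)
  · exact Or.inr (Or.inr ⟨h2, h1, i, hi, by rwa [abs_sub_comm], h5, h4⟩)

lemma GridLink.mono {k k' : ℕ} (hk : k ≤ k') {p q : ℤ × ℤ} (h : GridLink k p q) :
    GridLink k' p q := by
  rcases h with h | h | ⟨h1, h2, i, hi, h3⟩
  · exact Or.inl h
  · exact Or.inr (Or.inl h)
  · exact Or.inr (Or.inr ⟨h1, h2, i, hi.trans hk, h3⟩)

lemma GridLink.shift {k : ℕ} {p q : ℤ × ℤ} (h : GridLink k p q) :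
    GridLink k (3 ^ (k + 2) + p.1, p.2) (3 ^ (k + 2) + q.1, q.2) := by
  rcases h with ⟨h1, h2⟩ | ⟨h1, h2⟩ | ⟨h1, h2, i, hi, h3, h4, h5⟩
  · exact Or.inl ⟨by simp [h1], h2⟩
  · exact Or.inr (Or.inl ⟨h1, by simpa using h2⟩)
  · have hd : (3 : ℤ) ^ i ∣ 3 ^ (k + 2) := pow_dvd_pow _ (by omega)
    exact Or.inr (Or.inr ⟨h1, h2, i, hi, by simpa using h3, dvd_add hd h4, dvd_add hd h5⟩)

/-- Reflection at a multiple of every `3 ^ i` in question preserves divisibility; this is why the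
copies are placed around column `3 ^ (k + 2)`. -/
lemma GridLink.mirror {k : ℕ} {p q : ℤ × ℤ} (h : GridLink k p q) :
    GridLink k (3 ^ (k + 2) - p.1, p.2) (3 ^ (k + 2) - q.1, q.2) := by
  rcases h.symm with ⟨h1, h2⟩ | ⟨h1, h2⟩ | ⟨h1, h2, i, hi, h3, h4, h5⟩
  · exact Or.inl ⟨by simp [h1], by rwa [abs_sub_comm]⟩
  · exact Or.inr (Or.inl ⟨h1.symm, by simpa using h2⟩)
  · have hd : (3 : ℤ) ^ i ∣ 3 ^ (k + 2) := pow_dvd_pow _ (by omega)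
    exact Or.inr (Or.inr ⟨h2, h1, i, hi, by simpa using h3, dvd_sub hd h5, dvd_sub hd h4⟩)

/-- The new jumps join columns that differ by `3 ^ (k + 1)` and are multiples of it, because each
copy ends at its image of column `3 ^ (k + 1)`. -/
lemma gridPath_isChain (k : ℕ) : (gridPath k).IsChain (GridLink k) := by
  induction k with
  | zero =>
    simp [gridPath, GridLink]
  | succ k ih =>
    have hh := head?_gridPath k
    have hl := getLast?_gridPath k
    have ih' : (gridPath k).IsChain (GridLink (k + 1)) := ih.imp fun _ _ h => h.mono k.le_succ
    have hd : (3 : ℤ) ^ (k + 1) ∣ 3 ^ (k + 2) := pow_dvd_pow _ (by omega)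
    rw [gridPath]
    refine List.isChain_append.2 ⟨ih', List.isChain_append.2 ⟨?_, List.isChain_cons.2 ⟨?_,
      List.isChain_append.2 ⟨?_, by simp, ?_⟩⟩, ?_⟩, ?_⟩
    · rw [List.isChain_reverse, List.isChain_map]
      exact ih.imp fun _ _ h => (h.mirror.symm).mono k.le_succ
    · intro y hy
      simp only [List.head?_append, List.head?_map, hh, Option.map_some, Option.some_or,
        Option.mem_some_iff] at hy
      subst hy
      exact Or.inr (Or.inl ⟨rfl, by simp⟩)
    · rw [List.isChain_map]
      exact ih.imp fun _ _ h => h.shift.mono k.le_succ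
    · intro x hx y hy
      simp only [List.getLast?_map, hl, Option.map_some, Option.mem_some_iff] at hx
      simp only [List.head?_cons, Option.mem_some_iff] at hy
      subst hx hy
      exact Or.inr (Or.inr ⟨rfl, rfl, k + 1, le_rfl, by simp, dvd_add hd dvd_rfl, hd⟩)
    · intro x hx y hy
      simp only [List.getLast?_reverse, List.head?_map, hh, Option.map_some,
        Option.mem_some_iff] at hx
      simp only [List.head?_cons, Option.mem_some_iff] at hy
      subst hx hy
      exact Or.inr (Or.inl ⟨rfl, by simp⟩)
    · intro x hx y hy
      simp only [hl, Option.mem_some_iff] at hx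
      simp only [List.head?_append, List.head?_reverse, List.getLast?_map, hl, Option.map_some,
        Option.some_or, Option.mem_some_iff] at hy
      subst hx hy
      refine Or.inr (Or.inr ⟨rfl, rfl, k + 1, le_rfl, ?_, dvd_rfl, dvd_sub hd dvd_rfl⟩)
      have : (3 : ℤ) ^ (k + 1) - (3 ^ (k + 2) - 3 ^ (k + 1)) = - 3 ^ (k + 1) := by ring
      simp [this]

/-- The points `(a, 0), …, (a + n - 1, 0)`. -/
def rowList (a : ℤ) (n : ℕ) : List (ℤ × ℤ) := (List.range n).map fun i : ℕ => (a + (i : ℤ), 0)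

lemma mem_rowList {a : ℤ} {n : ℕ} {p : ℤ × ℤ} :
    p ∈ rowList a n ↔ a ≤ p.1 ∧ p.1 < a + n ∧ p.2 = 0 := by
  obtain ⟨x, y⟩ := p
  simp only [rowList, List.mem_map, List.mem_range, Prod.mk.injEq]
  constructor
  · rintro ⟨i, hi, rfl, rfl⟩
    omega
  · rintro ⟨h1, h2, h3⟩
    exact ⟨(x - a).toNat, by omega, by omega, h3.symm⟩

lemma rowList_nodup (a : ℤ) (n : ℕ) : (rowList a n).Nodup :=
  List.nodup_range.map fun i j h => by
    simp only [Prod.mk.injEq] at h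
    omega

lemma rowList_isChain (a : ℤ) (n k : ℕ) : (rowList a n).IsChain (GridLink k) := by
  rw [rowList, List.isChain_map, List.isChain_range]
  intro i _
  exact Or.inr (Or.inl ⟨rfl, by simp⟩)

lemma head?_rowList (a : ℤ) (n : ℕ) : (rowList a (n + 1)).head? = some (a, 0) := by
  simp [rowList, List.head?_range]

lemma getLast?_rowList (a : ℤ) (n : ℕ) : (rowList a (n + 1)).getLast? = some (a + n, 0) := by
  simp [rowList, List.range_succ]

/-- A grid path preceded by `m` points to the left of the bottom row. -/
def tailedPath (m k : ℕ) : List (ℤ × ℤ) := rowList (1 - m) m ++ gridPath k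

lemma mem_tailedPath {m k : ℕ} {p : ℤ × ℤ} : p ∈ tailedPath m k ↔
    2 * p.1 + 1 ≤ 3 ^ (k + 2) ∧ (p.2 = 0 ∧ 1 - (m : ℤ) ≤ p.1 ∨ p.2 = 1 ∧ 1 ≤ p.1) := by
  have hpos : (9 : ℤ) ≤ 3 ^ (k + 2) := by
    have : (1 : ℤ) ≤ 3 ^ k := one_le_pow₀ (by norm_num)
    rw [pow_add]; linarith
  rw [tailedPath, List.mem_append, mem_rowList, mem_gridPath]
  omega

lemma tailedPath_nodup (m k : ℕ) : (tailedPath m k).Nodup := by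
  refine (rowList_nodup _ _).append (gridPath_nodup k) fun p h1 h2 => ?_
  rw [mem_rowList] at h1
  rw [mem_gridPath] at h2
  omega

lemma length_tailedPath (m k : ℕ) : (tailedPath m k).length + 1 = m + 3 ^ (k + 2) := by
  rw [tailedPath, List.length_append, rowList, List.length_map, List.length_range, add_assoc,
    length_gridPath]

lemma head?_tailedPath (m k : ℕ) : (tailedPath m k).head? = some (1 - (m : ℤ), 0) := by
  cases m with
  | zero => simp [tailedPath, rowList, head?_gridPath]
  | succ m => rw [tailedPath, List.head?_append, head?_rowList]; rfl

lemma getLast?_tailedPath (m k : ℕ) : (tailedPath m k).getLast? = some (3 ^ (k + 1), 1) := by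
  rw [tailedPath, List.getLast?_append, getLast?_gridPath]; rfl

lemma tailedPath_isChain (m k : ℕ) : (tailedPath m k).IsChain (GridLink k) := by
  refine List.isChain_append.2 ⟨rowList_isChain _ _ _, gridPath_isChain k, fun x hx y hy => ?_⟩
  cases m with
  | zero => simp [rowList] at hx
  | succ m =>
    rw [getLast?_rowList, Option.mem_some_iff] at hx
    rw [head?_gridPath, Option.mem_some_iff] at hy
    subst hx hy
    exact Or.inr (Or.inl ⟨rfl, by push_cast; norm_num⟩)

lemma le_pathLength_tailedPath (m k : ℕ) :
    (2 * (k : ℝ) + 8) * 3 ^ k - 1 ≤ pathLength taxiDist (tailedPath m k) := by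
  rw [← pathLength_gridPath]
  cases m with
  | zero => simp [tailedPath, rowList]
  | succ m =>
    rw [tailedPath, pathLength_append (getLast?_rowList _ _) (head?_gridPath k)]
    have h0 : ∀ x y, 0 ≤ taxiDist x y := fun x y => by unfold taxiDist; positivity
    have := pathLength_nonneg h0 (rowList (1 - ((m + 1 : ℕ) : ℤ)) (m + 1))
    linarith [h0 (1 - ((m + 1 : ℕ) : ℤ) + m, 0) (1, 0)]

end GridPath

/-! ### Greedy behaviour of the grid path for axis-compatible lengths -/

/-- The edge lengths `c` for cities at the integral points `pos` agree with the Euclidean distance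
on pairs with a common coordinate and are at least the difference of the x-coordinates. -/
structure IsAxisCost {V : Type} (pos : V → ℤ × ℤ) (c : Sym2 V → ℝ) : Prop where
  same_x : ∀ u v, u ≠ v → (pos u).1 = (pos v).1 → c s(u, v) = (|(pos u).2 - (pos v).2| : ℤ)
  same_y : ∀ u v, u ≠ v → (pos u).2 = (pos v).2 → c s(u, v) = (|(pos u).1 - (pos v).1| : ℤ)
  le : ∀ u v, u ≠ v → ((|(pos u).1 - (pos v).1| : ℤ) : ℝ) ≤ c s(u, v)

namespace IsAxisCost

variable {V : Type} {pos : V → ℤ × ℤ} {c : Sym2 V → ℝ}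

lemma one_le (hc : IsAxisCost pos c) (hpos : Function.Injective pos) {u v : V} (huv : u ≠ v) :
    1 ≤ c s(u, v) := by
  by_cases hx : (pos u).1 = (pos v).1
  · have hy : (pos u).2 ≠ (pos v).2 := fun hy => huv (hpos (Prod.ext hx hy))
    rw [hc.same_x u v huv hx]
    exact_mod_cast Int.one_le_abs (sub_ne_zero.2 hy)
  · refine le_trans ?_ (hc.le u v huv)
    exact_mod_cast Int.one_le_abs (sub_ne_zero.2 hx)

lemma eq_taxiDist (hc : IsAxisCost pos c) {u v : V} (huv : u ≠ v) {k : ℕ}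
    (h : GridLink k (pos u) (pos v)) : c s(u, v) = taxiDist (pos u) (pos v) := by
  unfold taxiDist
  rcases h with ⟨h1, -⟩ | ⟨h1, -⟩ | ⟨h1, h2, -⟩
  · rw [hc.same_x u v huv h1, h1]; simp
  · rw [hc.same_y u v huv h1, h1]; simp
  · rw [hc.same_y u v huv (h1.trans h2.symm), h1, h2]; simp

/-- An edge of a grid path has length one or is long and belongs to the top row. -/
lemma link_cases (hc : IsAxisCost pos c) {u v : V} (huv : u ≠ v) {k : ℕ}
    (h : GridLink k (pos u) (pos v)) : c s(u, v) = 1 ∨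
      ∃ i ≤ k, c s(u, v) = 3 ^ i ∧ ((pos u).2 = 1 ∧ (3 : ℤ) ^ i ∣ (pos u).1) ∧
        ((pos v).2 = 1 ∧ (3 : ℤ) ^ i ∣ (pos v).1) := by
  rcases h with ⟨h1, h2⟩ | ⟨h1, h2⟩ | ⟨h1, h2, i, hi, h3, h4, h5⟩
  · left; rw [hc.same_x u v huv h1, h2]; simp
  · left; rw [hc.same_y u v huv h1, h2]; simp
  · refine Or.inr ⟨i, hi, ?_, ⟨h1, h4⟩, h2, h5⟩
    rw [hc.same_y u v huv (h1.trans h2.symm), h3]; simp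

/-- A link of length `3 ^ i` with `i ≥ j` would make its ends top row multiples of `3 ^ j`. So at
any other point all path edges come before length `3 ^ j`. -/
lemma cost_lt_of_link (hc : IsAxisCost pos c) {u v : V} (huv : u ≠ v) {k j : ℕ} (hj : 1 ≤ j)
    (h : GridLink k (pos u) (pos v))
    (h' : k < j ∨ ¬ ((pos u).2 = 1 ∧ (3 : ℤ) ^ j ∣ (pos u).1)) : c s(u, v) < 3 ^ j := by
  rcases hc.link_cases huv h with h1 | ⟨i, hi, h1, h2, -⟩
  · rw [h1]
    exact one_lt_pow₀ (by norm_num) (by omega)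
  · have hij : i < j := by
      rcases h' with h' | h'
      · omega
      · by_contra hij
        exact h' ⟨h2.1, (pow_dvd_pow _ (by omega)).trans h2.2⟩
    rw [h1]
    exact pow_lt_pow_right₀ (by norm_num) hij

lemma pathLength_eq [DecidableEq V] (hc : IsAxisCost pos c) {k : ℕ} {l : List V} (hl : l.Nodup)
    (h3 : 3 ≤ l.length) (hch : (l.map pos).IsChain (GridLink k)) :
    pathLength (edgeDist c) l = pathLength taxiDist (l.map pos) := by
  rw [pathLength_map (d' := fun u v => taxiDist (pos u) (pos v)) fun _ _ => rfl, pathLength,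
    pathLength]
  congr 1
  refine List.map_congr_left ?_
  rintro ⟨u, v⟩ h
  have huv : u ≠ v := tourPairs_ne hl h3 (pathPairs_subset_tourPairs h)
  simp only [edgeDist_of_ne c huv]
  exact hc.eq_taxiDist huv (rel_of_mem_pathPairs ((List.isChain_map pos).1 hch) h)

variable [DecidableEq V] [Fintype V]

/-- Path edges shorter than `3 ^ j` and an edge shorter than `3 ^ j` that joins the head of the path
to a top row point with x-coordinate divisible by `3 ^ j` contain a short cycle. -/
lemma not_extends_head (hc : IsAxisCost pos c) (hpos : Function.Injective pos) {m k j : ℕ}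
    (hj : 1 ≤ j) (hjk : j ≤ k) {l : List V} (hall : ∀ v, v ∈ l) (hl : l.map pos = tailedPath m k)
    {u v : V} (hu : pos u = (1 - (m : ℤ), 0)) (hv : (pos v).2 = 1) (hvj : (3 : ℤ) ^ j ∣ (pos v).1)
    (hlt : |(pos u).1 - (pos v).1| < 3 ^ j) :
    ¬ ExtendsToTour (insert s(u, v)
      ((pathEdges l).toFinset.filter fun e' => c e' < 3 ^ j)) := by
  rintro ⟨T, hT, hFT⟩
  have hnod : l.Nodup := List.Nodup.of_map pos (hl ▸ tailedPath_nodup m k)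
  have huvT : s(u, v) ∈ T := hFT (Finset.mem_insert_self _ _)
  obtain ⟨i, rfl⟩ : ∃ i, j = i + 1 := ⟨j - 1, by omega⟩
  -- The x-coordinate of `v` is a positive multiple of `3 ^ j` and that of the head is `1 - m`. A
  -- difference below `3 ^ j` leaves only the first multiple and no tail.
  have hmv : m = 0 ∧ (pos v).1 = 3 ^ (i + 1) := by
    have h1 := mem_tailedPath.1 (hl ▸ List.mem_map_of_mem (hall v) : pos v ∈ tailedPath m k)
    have h3 : (3 : ℤ) ≤ 3 ^ (i + 1) := by
      have : (1 : ℤ) ≤ 3 ^ i := one_le_pow₀ (by norm_num)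
      rw [pow_succ]; linarith
    rw [abs_lt, hu] at hlt
    obtain ⟨t, ht⟩ := hvj
    generalize (3 : ℤ) ^ (i + 1) = N at *
    have ht1 : 1 ≤ t := by
      by_contra h
      have : N * t ≤ 0 := mul_nonpos_of_nonneg_of_nonpos (by omega) (by omega)
      omega
    have ht2 : t = 1 := by
      by_contra h
      have : N * 2 ≤ N * t := mul_le_mul_of_nonneg_left (by omega) (by omega)
      omega
    subst ht2
    omega
  obtain ⟨rfl, hv1⟩ := hmv
  -- Now `u` and `v` are the two ends of the initial segment of level `i = j - 1`, all of whose
  -- edges are shorter than `3 ^ j`.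
  obtain ⟨B, hB⟩ := gridPath_prefix (show i ≤ k by omega)
  have hl' : l.map pos = gridPath i ++ B := by
    rw [hl, ← hB]; simp [tailedPath, rowList]
  obtain ⟨l₁, l₂, rfl, h₁, -⟩ := List.map_eq_append_iff.1 hl'
  have hlen : 8 ≤ l₁.length := by
    have h := length_gridPath i
    rw [← h₁, List.length_map, pow_add] at h
    have : 1 ≤ 3 ^ i := Nat.one_le_pow _ _ (by norm_num)
    omega
  have hne : l₁ ≠ [] := by rintro rfl; simp at hlen
  have hnod₁ : l₁.Nodup := hnod.of_append_left
  have hhead : l₁.head hne = u := by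
    have := head?_gridPath i
    rw [← h₁, List.head?_map, List.head?_eq_some_head hne, Option.map_some, Option.some_inj] at this
    exact hpos (by rw [this, hu]; simp)
  have hlast : l₁.getLast hne = v := by
    have := getLast?_gridPath i
    rw [← h₁, List.getLast?_map, List.getLast?_eq_some_getLast hne, Option.map_some,
      Option.some_inj] at this
    exact hpos (by rw [this]; exact Prod.ext hv1.symm hv.symm)
  have hch : l₁.IsChain fun a b => GridLink i (pos a) (pos b) :=
    (List.isChain_map pos).1 (h₁ ▸ gridPath_isChain i)
  have hpair : ∀ {a b : V}, (a, b) ∈ pathPairs l₁ → s(a, b) ∈ T ∧ a ∈ l₁ ∧ b ∈ l₁ := by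
    intro a b hab
    have hab' := pathPairs_subset_tourPairs hab
    refine ⟨hFT (Finset.mem_insert_of_mem (Finset.mem_filter.2 ⟨List.mem_toFinset.2
      (mem_pathEdges.2 (Or.inl (pathPairs_infix (A := []) hab))), ?_⟩)),
      mem_of_mem_tourPairs hab'⟩
    exact hc.cost_lt_of_link (tourPairs_ne hnod₁ (by omega) hab') hj (rel_of_mem_pathPairs hch hab)
      (Or.inl (by omega))
  -- The segment together with `uv` is a cycle: each of its cities has both tour neighbours inside,
  -- so the tour cannot leave it.
  have hnb : ∀ a ∈ l₁, ∃ p ∈ l₁, ∃ q ∈ l₁, p ≠ q ∧ s(a, p) ∈ T ∧ s(a, q) ∈ T := by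
    intro a ha
    by_cases hau : a = u
    · have hp : (l₁[0], l₁[1]) ∈ pathPairs l₁ := mem_pathPairs_iff.2 ⟨0, by omega, rfl, rfl⟩
      rw [← List.head_eq_getElem hne, hhead] at hp
      refine ⟨l₁[1], by simp, v, hlast ▸ List.getLast_mem hne, ?_, hau ▸ (hpair hp).1, hau ▸ huvT⟩
      rw [← hlast, List.getLast_eq_getElem, Ne, hnod₁.getElem_inj_iff]
      omega
    by_cases hav : a = v
    · have hp : (l₁[l₁.length - 2], l₁[l₁.length - 1]) ∈ pathPairs l₁ :=
        mem_pathPairs_iff.2 ⟨l₁.length - 2, by omega, rfl, by congr 1; omega⟩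
      rw [← List.getLast_eq_getElem hne, hlast] at hp
      refine ⟨l₁[l₁.length - 2], by simp, u, hhead ▸ List.head_mem hne, ?_,
        by rw [hav, Sym2.eq_swap]; exact (hpair hp).1, by rw [hav, Sym2.eq_swap]; exact huvT⟩
      rw [← hhead, List.head_eq_getElem, Ne, hnod₁.getElem_inj_iff]
      omega
    · obtain ⟨p, q, hp, hq, hpq⟩ := exists_neighbors_of_interior hnod₁ hne ha
        (by rwa [hhead]) (by rwa [hlast])
      exact ⟨p, (hpair hp).2.1, q, (hpair hq).2.2, hpq, by rw [Sym2.eq_swap]; exact (hpair hp).1,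
        (hpair hq).1⟩
  have hclosed : ∀ a b, a ∈ {w | w ∈ l₁} → s(a, b) ∈ T → b ∈ {w | w ∈ l₁} := by
    intro a b ha hab
    by_contra hb
    obtain ⟨p, hp, q, hq, hpq, h1, h2⟩ := hnb a ha
    exact hT.not_three_neighbors h1 h2 hab hpq (fun h => hb (h ▸ hp)) (fun h => hb (h ▸ hq))
  have hu₁ : u ∈ {w | w ∈ l₁} := by
    change u ∈ l₁
    rw [← hhead]; exact List.head_mem hne
  -- The end of the whole path would lie in the segment, but its column `3 ^ (k + 1)` is too far to
  -- the right as `i < k`.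
  have hz : ((3 : ℤ) ^ (k + 1), (1 : ℤ)) ∈ gridPath i := by
    obtain ⟨z, hz, hz'⟩ : ∃ z ∈ l₁ ++ l₂, pos z = (3 ^ (k + 1), 1) := by
      rw [← List.mem_map, hl]
      exact List.mem_of_getLast? (getLast?_tailedPath 0 k)
    rw [← hz', ← h₁]
    exact List.mem_map_of_mem (hT.eq_univ_of_closed hu₁ hclosed z)
  have h1 := (mem_gridPath.1 hz).2.1
  have h2 : (3 : ℤ) ^ (i + 2) ≤ 3 ^ (k + 1) := pow_le_pow_right₀ (by norm_num) (by omega)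
  simp only at h1
  have h3 : (1 : ℤ) ≤ 3 ^ (k + 1) := one_le_pow₀ (by norm_num)
  omega

/-- The closed tailed grid path is a greedy tour. -/
theorem isGreedyTour_tailedPath (hc : IsAxisCost pos c) (hpos : Function.Injective pos) {m k : ℕ}
    {l : List V} (hall : ∀ v, v ∈ l) (hl : l.map pos = tailedPath m k) :
    IsGreedyTour c (tourEdges l) := by
  have hnod : l.Nodup := List.Nodup.of_map pos (hl ▸ tailedPath_nodup m k)
  have h3 : 3 ≤ l.length := by
    have h := length_tailedPath m k
    rw [← hl, List.length_map, pow_add] at h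
    have : 1 ≤ 3 ^ k := Nat.one_le_pow _ _ (by norm_num)
    omega
  have hne : l ≠ [] := by rintro rfl; simp at h3
  have hhead : pos (l.head hne) = (1 - (m : ℤ), 0) := by
    have := head?_tailedPath m k
    rwa [← hl, List.head?_map, List.head?_eq_some_head hne, Option.map_some,
      Option.some_inj] at this
  have hlast : pos (l.getLast hne) = (3 ^ (k + 1), 1) := by
    have := getLast?_tailedPath m k
    rwa [← hl, List.getLast?_map, List.getLast?_eq_some_getLast hne, Option.map_some,
      Option.some_inj] at this
  have hch : l.IsChain fun a b => GridLink k (pos a) (pos b) :=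
    (List.isChain_map pos).1 (hl ▸ tailedPath_isChain m k)
  have hpair_ne : ∀ {a b : V}, (a, b) ∈ pathPairs l → a ≠ b := fun h =>
    tourPairs_ne hnod h3 (pathPairs_subset_tourPairs h)
  refine isGreedyTour_tourEdges hnod hall h3 fun e he f hf hlt hext => ?_
  -- Unit edges count as `j = 0`, where no cheaper edge exists since distinct lattice points have
  -- length at least one.
  obtain ⟨j, hjk, hj⟩ : ∃ j ≤ k, c e = 3 ^ j := by
    simp only [pathEdges, List.mem_map, Prod.exists] at he
    obtain ⟨a, b, hab, rfl⟩ := he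
    rcases hc.link_cases (hpair_ne hab) (rel_of_mem_pathPairs hch hab) with h | ⟨i, hi, h, -⟩
    · exact ⟨0, by omega, by simpa using h⟩
    · exact ⟨i, hi, h⟩
  rw [hj] at hlt hext
  induction f with | _ u v
  have hext' := hext
  obtain ⟨T, hT, hFT⟩ := hext
  have huvT : s(u, v) ∈ T := hFT (Finset.mem_insert_self _ _)
  have huv : u ≠ v := hT.ne huvT
  have hj1 : 1 ≤ j := by
    by_contra h
    obtain rfl : j = 0 := by omega
    rw [pow_zero] at hlt
    exact absurd (hc.one_le hpos huv) (not_le.2 hlt)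
  have hdist : |(pos u).1 - (pos v).1| < 3 ^ j := by
    exact_mod_cast (hc.le u v huv).trans_lt hlt
  -- At any other city both path edges are shorter than `3 ^ j`, hence already present. The last
  -- city of the path is no exception: its column `3 ^ (k + 1)` is a multiple of `3 ^ j`.
  have key : ∀ a b : V, s(a, b) = s(u, v) →
      a = l.head hne ∨ (pos a).2 = 1 ∧ (3 : ℤ) ^ j ∣ (pos a).1 := by
    intro a b hab
    by_contra! h
    have hnot : ¬ ((pos a).2 = 1 ∧ (3 : ℤ) ^ j ∣ (pos a).1) := fun h' => h.2 h'.1 h'.2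
    obtain ⟨p, q, hp, hq, hpq⟩ := exists_neighbors_of_interior hnod hne (hall a) h.1 (by
      rintro rfl
      rw [hlast] at hnot
      exact hnot ⟨rfl, pow_dvd_pow _ (by omega)⟩)
    have hpa : s(a, p) ∈ T := by
      refine hFT (Finset.mem_insert_of_mem (Finset.mem_filter.2 ⟨List.mem_toFinset.2
        (mem_pathEdges.2 (Or.inr hp)), ?_⟩))
      exact hc.cost_lt_of_link (hpair_ne hp).symm hj1 (rel_of_mem_pathPairs hch hp).symm
        (Or.inr hnot)
    have haq : s(a, q) ∈ T := by
      refine hFT (Finset.mem_insert_of_mem (Finset.mem_filter.2 ⟨List.mem_toFinset.2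
        (mem_pathEdges.2 (Or.inl hq)), ?_⟩))
      exact hc.cost_lt_of_link (hpair_ne hq) hj1 (rel_of_mem_pathPairs hch hq) (Or.inr hnot)
    rw [← hab] at hf huvT
    refine hT.not_three_neighbors hpa haq huvT hpq ?_ ?_
    · rintro rfl; exact hf (mem_pathEdges.2 (Or.inr hp))
    · rintro rfl; exact hf (mem_pathEdges.2 (Or.inl hq))
  rcases key u v rfl with hu | ⟨hu, hu'⟩ <;> rcases key v u Sym2.eq_swap with hv | ⟨hv, hv'⟩
  · exact huv (hu.trans hv.symm)
  · exact hc.not_extends_head hpos hj1 hjk hall hl (hu ▸ hhead) hv hv' hdist hext'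
  · rw [Sym2.eq_swap] at hext'
    rw [abs_sub_comm] at hdist
    exact hc.not_extends_head hpos hj1 hjk hall hl (hv ▸ hhead) hu hu' hdist hext'
  · refine huv (hpos (Prod.ext ?_ (hu.trans hv.symm)))
    have := Int.eq_zero_of_abs_lt_dvd (dvd_sub hu' hv') hdist
    omega

end IsAxisCost

/-! ### Short comparison tours along the boundary -/

section BoundaryTour

/-- The points `(1 - m, 0), …, (w, 0), (w, 1), …, (1, 1)`. -/
def boundaryList (m w : ℕ) : List (ℤ × ℤ) :=
  rowList (1 - m) (m + w) ++ ((rowList 1 w).map fun p => (p.1, 1)).reverse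

lemma mem_boundaryList {m w : ℕ} {p : ℤ × ℤ} : p ∈ boundaryList m w ↔
    p.1 ≤ w ∧ (p.2 = 0 ∧ 1 - (m : ℤ) ≤ p.1 ∨ p.2 = 1 ∧ 1 ≤ p.1) := by
  obtain ⟨x, y⟩ := p
  simp only [boundaryList, List.mem_append, List.mem_reverse, List.mem_map, mem_rowList,
    Prod.exists, Prod.mk.injEq]
  constructor
  · rintro (h | ⟨a, b, h, rfl, rfl⟩)
    · push_cast at h; omega
    · omega
  · rintro ⟨h, h' | h'⟩
    · left; push_cast; omega
    · exact Or.inr ⟨x, 0, by omega, rfl, h'.1.symm⟩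

lemma boundaryList_nodup (m w : ℕ) : (boundaryList m w).Nodup := by
  refine (rowList_nodup _ _).append (List.nodup_reverse.2 ((rowList_nodup _ _).map_on ?_)) ?_
  · intro p hp q hq h
    rw [mem_rowList] at hp hq
    simp only [Prod.mk.injEq] at h
    exact Prod.ext h.1 (by omega)
  · intro p h1 h2
    rw [mem_rowList] at h1
    simp only [List.mem_reverse, List.mem_map] at h2
    obtain ⟨q, -, rfl⟩ := h2
    simp at h1

lemma length_boundaryList (m w : ℕ) : (boundaryList m w).length = m + 2 * w := by
  simp [boundaryList, rowList]
  ring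

lemma boundaryList_isChain (m w : ℕ) : (boundaryList m w).IsChain (GridLink 0) := by
  refine List.isChain_append.2 ⟨rowList_isChain _ _ _, ?_, ?_⟩
  · rw [List.isChain_reverse, List.isChain_map]
    rw [rowList, List.isChain_map, List.isChain_range]
    intro i _
    exact Or.inr (Or.inl ⟨rfl, by simp⟩)
  · intro x hx y hy
    cases w with
    | zero => simp [rowList] at hy
    | succ w =>
      rw [← add_assoc, getLast?_rowList, Option.mem_some_iff] at hx
      rw [List.head?_reverse, List.getLast?_map, getLast?_rowList, Option.map_some,
        Option.mem_some_iff] at hy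
      subst hx hy
      exact Or.inl ⟨by push_cast; ring, rfl⟩

lemma head?_boundaryList_zero (w : ℕ) : (boundaryList 0 (w + 1)).head? = some (1, 0) := by
  rw [boundaryList, zero_add, List.head?_append, head?_rowList]; rfl

lemma getLast?_boundaryList_zero (w : ℕ) : (boundaryList 0 (w + 1)).getLast? = some (1, 1) := by
  rw [boundaryList, List.getLast?_append, List.getLast?_reverse, List.head?_map, head?_rowList]; rfl

lemma taxiDist_of_gridLink_zero {p q : ℤ × ℤ} (h : GridLink 0 p q) : taxiDist p q = 1 := by
  unfold taxiDist
  rcases h with ⟨h1, h2⟩ | ⟨h1, h2⟩ | ⟨h1, h2, i, hi, h3, -⟩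
  · rw [h1, h2]; simp
  · rw [h1, h2]; simp
  · obtain rfl : i = 0 := by omega
    rw [h1, h2, h3]; simp

lemma pathLength_of_unit_steps {l : List (ℤ × ℤ)} (hne : l ≠ []) (h : l.IsChain (GridLink 0)) :
    pathLength taxiDist l = (l.length : ℝ) - 1 := by
  induction l with
  | nil => exact absurd rfl hne
  | cons a l ih =>
    cases l with
    | nil => simp
    | cons b l =>
      rw [List.isChain_cons_cons] at h
      rw [pathLength_cons_cons, ih (by simp) h.2, taxiDist_of_gridLink_zero h.1]
      simp [add_comm]

/-- Carries the explicit lists of lattice points over to an arbitrary type of cities. -/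
lemma exists_list_lift {V W : Type} {f : V → W} (hf : Function.Injective f) {L : List W}
    (h : ∀ w, w ∈ Set.range f ↔ w ∈ L) : ∃ l : List V, l.map f = L ∧ ∀ v, v ∈ l := by
  obtain ⟨l, rfl⟩ : L ∈ Set.range (List.map f) := by
    rw [Set.range_list_map]
    exact fun w hw => (h w).2 hw
  refine ⟨l, rfl, fun v => ?_⟩
  obtain ⟨v', hv', e⟩ := List.mem_map.1 ((h (f v)).1 ⟨v, rfl⟩)
  exact hf e ▸ hv'

variable {V : Type} [DecidableEq V] [Fintype V] {pos : V → ℤ × ℤ} {c : Sym2 V → ℝ}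

lemma card_of_range_eq_boundaryList (hpos : Function.Injective pos) {m w : ℕ}
    (hr : ∀ p, p ∈ Set.range pos ↔ p ∈ boundaryList m w) : Fintype.card V = m + 2 * w := by
  obtain ⟨l, hl, hall⟩ := exists_list_lift hpos hr
  have hnod : l.Nodup := List.Nodup.of_map pos (hl ▸ boundaryList_nodup m w)
  rw [← length_eq_card hnod hall, ← length_boundaryList, ← hl, List.length_map]

/-- The tour along the boundary of the grid has length `n`. -/
lemma IsAxisCost.exists_tour_of_grid (hc : IsAxisCost pos c) (hpos : Function.Injective pos)
    {w : ℕ} (hw : 2 ≤ w) (hr : ∀ p, p ∈ Set.range pos ↔ p ∈ boundaryList 0 w) :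
    ∃ T, IsTour T ∧ edgeLength c T = 2 * w := by
  obtain ⟨l, hl, hall⟩ := exists_list_lift hpos hr
  have hnod : l.Nodup := List.Nodup.of_map pos (hl ▸ boundaryList_nodup 0 w)
  have hlen : l.length = 0 + 2 * w := by
    rw [← length_boundaryList, ← hl, List.length_map]
  have hne : l ≠ [] := by rintro rfl; simp at hlen; omega
  refine ⟨tourEdges l, isTour_iff.2 ⟨l, hnod, hall, by omega, rfl⟩, ?_⟩
  obtain ⟨w, rfl⟩ : ∃ w', w = w' + 1 := ⟨w - 1, by omega⟩
  have hhead : pos (l.head hne) = (1, 0) := by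
    have := head?_boundaryList_zero w
    rwa [← hl, List.head?_map, List.head?_eq_some_head hne, Option.map_some,
      Option.some_inj] at this
  have hlast : pos (l.getLast hne) = (1, 1) := by
    have := getLast?_boundaryList_zero w
    rwa [← hl, List.getLast?_map, List.getLast?_eq_some_getLast hne, Option.map_some,
      Option.some_inj] at this
  have hch := boundaryList_isChain 0 (w + 1)
  rw [edgeLength_tourEdges c hnod (by omega) hne,
    hc.pathLength_eq hnod (by omega) (hl ▸ hch), pathLength_of_unit_steps (by simpa using hne)
    (hl ▸ hch), hc.same_x _ _ (fun h => by rw [h, hhead] at hlast; simp at hlast)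
    (by rw [hlast, hhead]), hlast, hhead, List.length_map, hlen]
  push_cast
  norm_num

lemma IsTour.card_le_edgeLength {T : Finset (Sym2 V)} (hT : IsTour T) (hc : IsAxisCost pos c)
    (hpos : Function.Injective pos) : (Fintype.card V : ℝ) ≤ edgeLength c T := by
  rw [← hT.card_eq, edgeLength, ← nsmul_one, ← Finset.sum_const]
  refine Finset.sum_le_sum fun e he => ?_
  induction e with | _ a b
  exact hc.one_le hpos (hT.ne he)

/-- In a metric instance there is a tour of length at most `2 n`. -/
lemma IsAxisCost.exists_tour_le (hc : IsAxisCost pos c) (hpos : Function.Injective pos)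
    (hc0 : ∀ e, 0 ≤ c e)
    (htri : ∀ x y z : V, x ≠ y → y ≠ z → x ≠ z → c s(x, z) ≤ c s(x, y) + c s(y, z))
    {m w : ℕ} (h3 : 3 ≤ m + 2 * w) (hr : ∀ p, p ∈ Set.range pos ↔ p ∈ boundaryList m w) :
    ∃ T, IsTour T ∧ edgeLength c T ≤ 2 * (m + 2 * w : ℕ) := by
  obtain ⟨l, hl, hall⟩ := exists_list_lift hpos hr
  have hnod : l.Nodup := List.Nodup.of_map pos (hl ▸ boundaryList_nodup m w)
  have hlen : l.length = m + 2 * w := by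
    rw [← length_boundaryList, ← hl, List.length_map]
  have hne : l ≠ [] := by rintro rfl; simp at hlen; omega
  refine ⟨tourEdges l, isTour_iff.2 ⟨l, hnod, hall, by omega, rfl⟩, ?_⟩
  have hch := boundaryList_isChain m w
  have h1 : pathLength (edgeDist c) l = ((m + 2 * w : ℕ) : ℝ) - 1 := by
    rw [hc.pathLength_eq hnod (by omega) (hl ▸ hch), pathLength_of_unit_steps (by simpa using hne)
      (hl ▸ hch), List.length_map, hlen]
  have hab : l.getLast hne ≠ l.head hne :=
    tourPairs_ne hnod (by omega) (by rw [tourPairs_eq hne]; simp)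
  -- With a tail the closing edge is long, but shortcutting the path to its two ends bounds it by
  -- the length of the path.
  have h2 : c s(l.getLast hne, l.head hne) ≤ pathLength (edgeDist c) l := by
    have h := pathLength_le_of_sublist (edgeDist_nonneg hc0) (edgeDist_triangle hc0 htri)
      (l' := [l.head hne, l.getLast hne]) (l := l) (by
        obtain ⟨a, t, rfl⟩ := List.exists_cons_of_ne_nil hne
        have ht : t ≠ [] := by rintro rfl; simp at hab
        rw [List.getLast_cons ht, List.head_cons]
        exact (List.singleton_sublist.2 (List.getLast_mem ht)).cons_cons a)
    rwa [pathLength_cons_cons, pathLength_singleton, add_zero, edgeDist_of_ne c hab.symm,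
      Sym2.eq_swap] at h
  rw [edgeLength_tourEdges c hnod (by omega) hne]
  linarith

/-- The points of a row in order form a greedy tour. -/
lemma IsAxisCost.exists_greedyTour_of_row (hc : IsAxisCost pos c) (hpos : Function.Injective pos)
    {m : ℕ} (h3 : 3 ≤ m) (hr : ∀ p, p ∈ Set.range pos ↔ p ∈ boundaryList m 0) :
    ∃ T, IsGreedyTour c T := by
  obtain ⟨l, hl, hall⟩ := exists_list_lift hpos hr
  have hnod : l.Nodup := List.Nodup.of_map pos (hl ▸ boundaryList_nodup m 0)
  have hlen : l.length = m + 2 * 0 := by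
    rw [← length_boundaryList, ← hl, List.length_map]
  refine ⟨_, isGreedyTour_tourEdges hnod hall (by omega) fun e he f _ hlt hext => ?_⟩
  obtain ⟨T, hT, hFT⟩ := hext
  simp only [pathEdges, List.mem_map, Prod.exists] at he
  obtain ⟨a, b, hab, rfl⟩ := he
  have hlink : GridLink 0 (pos a) (pos b) := rel_of_mem_pathPairs
    ((List.isChain_map pos).1 (hl ▸ boundaryList_isChain m 0)) hab
  rw [hc.eq_taxiDist (tourPairs_ne hnod (by omega) (pathPairs_subset_tourPairs hab)) hlink,
    taxiDist_of_gridLink_zero hlink] at hlt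
  induction f with | _ u v
  exact absurd (hc.one_le hpos (hT.ne (hFT (Finset.mem_insert_self _ _)))) (not_le.2 hlt)

end BoundaryTour

/-! ### Greedy tours on grids with a tail -/

/-- The number of columns of the `k`-th grid. -/
abbrev gridWidth (k : ℕ) : ℕ := (3 ^ (k + 2) - 1) / 2

lemma two_mul_gridWidth (k : ℕ) : 2 * gridWidth k + 1 = 3 ^ (k + 2) := by
  have h : Odd (3 ^ (k + 2)) := Odd.pow (by decide)
  obtain ⟨w, hw⟩ := h
  rw [gridWidth, hw]
  omega

lemma four_le_gridWidth (k : ℕ) : 4 ≤ gridWidth k := by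
  have h := two_mul_gridWidth k
  have : 1 ≤ 3 ^ k := Nat.one_le_pow _ _ (by norm_num)
  rw [pow_add] at h
  omega

section GreedyTours

variable {V : Type} [DecidableEq V] [Fintype V] {pos : V → ℤ × ℤ} {c : Sym2 V → ℝ}

lemma mem_boundaryList_iff_mem_tailedPath {m k : ℕ} {p : ℤ × ℤ} :
    p ∈ boundaryList m (gridWidth k) ↔ p ∈ tailedPath m k := by
  have h : (2 * gridWidth k + 1 : ℤ) = 3 ^ (k + 2) := by exact_mod_cast two_mul_gridWidth k
  rw [mem_boundaryList, mem_tailedPath, ← h]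
  omega

/-- A greedy tour that contains the tailed grid path. -/
lemma IsAxisCost.exists_greedyTour (hc : IsAxisCost pos c) (hpos : Function.Injective pos)
    {m k : ℕ} (hr : ∀ p, p ∈ Set.range pos ↔ p ∈ boundaryList m (gridWidth k)) :
    ∃ (u v : V) (P : (⊤ : SimpleGraph V).Walk u v), P.IsPath ∧ (∀ x, x ∈ P.support) ∧
      (P.edges.map c).sum = pathLength taxiDist (tailedPath m k) ∧
      ∃ T, IsGreedyTour c T ∧ (∀ e ∈ P.edges, e ∈ T) ∧
        pathLength taxiDist (tailedPath m k) < edgeLength c T := by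
  obtain ⟨l, hl, hall⟩ := exists_list_lift hpos
    (fun p => (hr p).trans mem_boundaryList_iff_mem_tailedPath)
  have hnod : l.Nodup := List.Nodup.of_map pos (hl ▸ tailedPath_nodup m k)
  have h3 : 3 ≤ l.length := by
    have h := length_tailedPath m k
    rw [← hl, List.length_map, pow_add] at h
    have : 1 ≤ 3 ^ k := Nat.one_le_pow _ _ (by norm_num)
    omega
  have hne : l ≠ [] := by rintro rfl; simp at h3
  have hlen := hc.pathLength_eq hnod h3 (hl ▸ tailedPath_isChain m k)
  obtain ⟨P, hP, hsup, hed⟩ := exists_walk_of_list hnod hne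
  refine ⟨_, _, P, hP, fun x => by rw [hsup]; exact hall x, ?_, tourEdges l,
    hc.isGreedyTour_tailedPath hpos hall hl, fun e he => ?_, ?_⟩
  · rw [hed, ← pathLength_edgeDist c hnod h3, hlen, hl]
  · rw [tourEdges_eq hne]
    rw [hed] at he
    exact Finset.mem_insert_of_mem (List.mem_toFinset.2 he)
  · rw [edgeLength_tourEdges c hnod h3 hne, hlen, hl]
    have hab : l.getLast hne ≠ l.head hne :=
      tourPairs_ne hnod h3 (by rw [tourPairs_eq hne]; simp)
    linarith [hc.one_le hpos hab]

end GreedyTours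

/-! ### Graph distances and plane distances as axis-compatible lengths -/

section GridGraphs

variable {V : Type} {pos : V → ℤ × ℤ} {G : SimpleGraph V}

lemma abs_sub_le_length_of_walk
    (hG : ∀ u v, G.Adj u v ↔ |(pos u).1 - (pos v).1| + |(pos u).2 - (pos v).2| = 1)
    {u v : V} (w : G.Walk u v) : |(pos u).1 - (pos v).1| ≤ w.length := by
  induction w with
  | nil => simp
  | @cons a b d h w ih =>
    have h1 := (hG _ _).1 h
    have h2 := abs_nonneg ((pos a).2 - (pos b).2)
    have h3 := abs_sub_le (pos a).1 (pos b).1 (pos d).1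
    rw [SimpleGraph.Walk.length_cons]
    push_cast
    linarith

/-- `hrow` says that a row has no gaps, so unit steps suffice. With `abs_sub_le_length_of_walk` this
determines the graph distance within a row. -/
lemma exists_walk_of_row
    (hG : ∀ u v, G.Adj u v ↔ |(pos u).1 - (pos v).1| + |(pos u).2 - (pos v).2| = 1)
    (hpos : Function.Injective pos)
    (hrow : ∀ u v x, (pos u).2 = (pos v).2 → (pos u).1 ≤ x → x ≤ (pos v).1 →
      ∃ w, pos w = (x, (pos u).2)) (d : ℕ) {u v : V} (hy : (pos u).2 = (pos v).2)
    (hx : (pos v).1 = (pos u).1 + d) : ∃ w : G.Walk u v, w.length = d := by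
  induction d generalizing v with
  | zero =>
    obtain rfl : u = v := hpos (Prod.ext (by rw [hx]; simp) hy)
    exact ⟨.nil, rfl⟩
  | succ d ih =>
    obtain ⟨z, hz⟩ := hrow u v ((pos u).1 + d) hy (by omega) (by omega)
    obtain ⟨w, hw⟩ := ih (v := z) (by rw [hz]) (by rw [hz])
    have hzv : G.Adj z v := by
      rw [hG, hz, hx, ← hy]
      simp
    exact ⟨w.concat hzv, by rw [SimpleGraph.Walk.length_concat, hw]⟩

/-- The shortest path distances in a grid graph with two rows. -/
lemma isAxisCost_graphCost
    (hG : ∀ u v, G.Adj u v ↔ |(pos u).1 - (pos v).1| + |(pos u).2 - (pos v).2| = 1)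
    (hpos : Function.Injective pos) (hy : ∀ u, (pos u).2 = 0 ∨ (pos u).2 = 1)
    (hrow : ∀ u v x, (pos u).2 = (pos v).2 → (pos u).1 ≤ x → x ≤ (pos v).1 →
      ∃ w, pos w = (x, (pos u).2))
    (hbot : ∀ u, ∃ w, pos w = ((pos u).1, 0)) [Nonempty V] :
    G.Connected ∧ IsAxisCost pos (graphCost G) := by
  have hwalk : ∀ u v, (pos u).2 = (pos v).2 →
      ∃ w : G.Walk u v, (w.length : ℤ) = |(pos u).1 - (pos v).1| := by
    intro u v huv
    rcases le_total (pos u).1 (pos v).1 with h | h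
    · obtain ⟨w, hw⟩ := exists_walk_of_row hG hpos hrow ((pos v).1 - (pos u).1).toNat huv (by omega)
      exact ⟨w, by rw [hw, abs_of_nonpos (by omega)]; omega⟩
    · obtain ⟨w, hw⟩ := exists_walk_of_row hG hpos hrow ((pos u).1 - (pos v).1).toNat huv.symm
        (by omega)
      exact ⟨w.reverse, by rw [SimpleGraph.Walk.length_reverse, hw, abs_of_nonneg (by omega)]; omega⟩
  have hadj : ∀ u v, u ≠ v → (pos u).1 = (pos v).1 → |(pos u).2 - (pos v).2| = 1 := by
    intro u v huv hx
    have hne : (pos u).2 ≠ (pos v).2 := fun h => huv (hpos (Prod.ext hx h))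
    rcases hy u with h | h <;> rcases hy v with h' | h' <;> simp [h, h'] at hne ⊢
  have hreach : ∀ u, ∃ w, (pos w).2 = 0 ∧ G.Reachable u w := by
    intro u
    obtain ⟨w, hw⟩ := hbot u
    refine ⟨w, by rw [hw], ?_⟩
    by_cases huw : u = w
    · rw [huw]
    · refine SimpleGraph.Adj.reachable ((hG u w).2 ?_)
      rw [hadj u w huw (by rw [hw]), hw]
      simp
  have hconn : G.Connected := by
    refine ⟨fun u v => ?_⟩
    obtain ⟨a, ha, hua⟩ := hreach u
    obtain ⟨b, hb, hvb⟩ := hreach v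
    obtain ⟨w, -⟩ := hwalk a b (ha.trans hb.symm)
    exact hua.trans (w.reachable.trans hvb.symm)
  have hle : ∀ u v, |(pos u).1 - (pos v).1| ≤ G.dist u v := by
    intro u v
    obtain ⟨w, hw⟩ := hconn.exists_walk_length_eq_dist u v
    exact hw ▸ abs_sub_le_length_of_walk hG w
  refine ⟨hconn, ⟨fun u v huv hx => ?_, fun u v huv hy => ?_, fun u v huv => ?_⟩⟩
  · have h1 := hadj u v huv hx
    have h2 : G.dist u v = 1 := by
      rw [SimpleGraph.dist_eq_one_iff_adj, hG, h1, hx]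
      simp
    change (G.dist u v : ℝ) = _
    rw [h1, h2]; simp
  · obtain ⟨w, hw⟩ := hwalk u v hy
    have h1 : (G.dist u v : ℤ) = |(pos u).1 - (pos v).1| :=
      le_antisymm (hw ▸ by exact_mod_cast G.dist_le w) (hle u v)
    change (G.dist u v : ℝ) = _
    rw [← h1]; simp
  · change _ ≤ (G.dist u v : ℝ)
    exact_mod_cast hle u v

/-- The points with integral coordinates `pos` in the plane. -/
noncomputable def latticePoint (p : ℝ≥0∞) (pos : V → ℤ × ℤ) (v : V) : PiLp p (fun _ : Fin 2 => ℝ) :=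
  WithLp.toLp p ![((pos v).1 : ℝ), ((pos v).2 : ℝ)]

lemma latticePoint_injective (p : ℝ≥0∞) (hpos : Function.Injective pos) :
    Function.Injective (latticePoint p pos) := by
  intro u v h
  have h0 := congrArg (fun x : PiLp p (fun _ : Fin 2 => ℝ) => x 0) h
  have h1 := congrArg (fun x : PiLp p (fun _ : Fin 2 => ℝ) => x 1) h
  simp only [latticePoint, Matrix.cons_val_zero, Matrix.cons_val_one] at h0 h1
  exact hpos (Prod.ext (by exact_mod_cast h0) (by exact_mod_cast h1))

/-- All `L^p` norms agree on vectors with one nonzero coordinate, and each dominates the absolute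
value of any coordinate. -/
lemma isAxisCost_pointCost (p : ℝ≥0∞) [Fact (1 ≤ p)] (pos : V → ℤ × ℤ) :
    IsAxisCost pos (pointCost p (latticePoint p pos)) := by
  refine ⟨fun u v _ h => ?_, fun u v _ h => ?_, fun u v _ => ?_⟩
  · change dist (latticePoint p pos u) (latticePoint p pos v) = _
    have : latticePoint p pos u - latticePoint p pos v =
        PiLp.single p (1 : Fin 2) (((pos u).2 : ℝ) - (pos v).2) := by
      ext i
      fin_cases i <;> simp [latticePoint, h]
    rw [dist_eq_norm, this, PiLp.norm_single, Real.norm_eq_abs]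
    push_cast; rfl
  · change dist (latticePoint p pos u) (latticePoint p pos v) = _
    have : latticePoint p pos u - latticePoint p pos v =
        PiLp.single p (0 : Fin 2) (((pos u).1 : ℝ) - (pos v).1) := by
      ext i
      fin_cases i <;> simp [latticePoint, h]
    rw [dist_eq_norm, this, PiLp.norm_single, Real.norm_eq_abs]
    push_cast; rfl
  · change _ ≤ dist (latticePoint p pos u) (latticePoint p pos v)
    rw [dist_eq_norm]
    refine le_trans (le_of_eq ?_) (PiLp.norm_apply_le _ 0)
    simp [latticePoint]

end GridGraphs

/-! ### Lower bounds on the approximation ratio -/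

section LowerBounds

/-- The class `C` contains instances on all grids with two rows and a tail. -/
def ContainsGrids (C : TSPInstance → Prop) : Prop :=
  ∀ m w : ℕ, 3 ≤ m + 2 * w → ∃ (I : TSPInstance) (pos : I.City → ℤ × ℤ), C I ∧ IsMetricTSP I ∧
    Function.Injective pos ∧ (∀ p, p ∈ Set.range pos ↔ p ∈ boundaryList m w) ∧
    IsAxisCost pos I.cost

lemma ContainsGrids.mono {C D : TSPInstance → Prop} (hC : ContainsGrids C) (h : ∀ I, C I → D I) :
    ContainsGrids D := fun m w h3 => by
  obtain ⟨I, pos, hI, hrest⟩ := hC m w h3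
  exact ⟨I, pos, h I hI, hrest⟩

lemma containsGrids_graphic : ContainsGrids IsGraphicTSP := by
  intro m w h3
  let V := {p : ℤ × ℤ // p ∈ (boundaryList m w).toFinset}
  have hmem : ∀ p, p ∈ (boundaryList m w).toFinset ↔
      p.1 ≤ w ∧ (p.2 = 0 ∧ 1 - (m : ℤ) ≤ p.1 ∨ p.2 = 1 ∧ 1 ≤ p.1) := fun p => by
    rw [List.mem_toFinset, mem_boundaryList]
  let G : SimpleGraph V :=
    { Adj := fun u v => |u.1.1 - v.1.1| + |u.1.2 - v.1.2| = 1
      symm := ⟨fun u v h => by rwa [abs_sub_comm v.1.1, abs_sub_comm v.1.2]⟩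
      loopless := ⟨fun u h => by simp at h⟩ }
  let pos : V → ℤ × ℤ := Subtype.val
  have hinj : Function.Injective pos := Subtype.val_injective
  have : Nonempty V := ⟨⟨(w, 0), (hmem _).2 (by simp; omega)⟩⟩
  obtain ⟨hconn, hcost⟩ := isAxisCost_graphCost (G := G) (pos := pos) (fun u v => Iff.rfl) hinj
    (fun u => by have := (hmem _).1 u.2; simp only [pos]; omega)
    (fun u v x huv h1 h2 => by
      have hu := (hmem _).1 u.2
      have hv := (hmem _).1 v.2
      simp only [pos] at *
      exact ⟨⟨(x, u.1.2), (hmem _).2 (by simp only; omega)⟩, rfl⟩)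
    (fun u => by
      have hu := (hmem _).1 u.2
      exact ⟨⟨(u.1.1, 0), (hmem _).2 ⟨hu.1, Or.inl ⟨rfl, by omega⟩⟩⟩, rfl⟩)
  let I : TSPInstance :=
    { City := V
      cost := graphCost G
      cost_nonneg := fun e => by
        induction e with | _ a b
        exact Nat.cast_nonneg _ }
  have hI : IsGraphicTSP I := ⟨G, hconn, rfl⟩
  exact ⟨I, pos, hI, hI.isMetricTSP, hinj,
    fun p => ⟨fun ⟨v, hv⟩ => hv ▸ List.mem_toFinset.1 v.2,
      fun h => ⟨⟨p, List.mem_toFinset.2 h⟩, rfl⟩⟩, hcost⟩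

lemma containsGrids_Lp (p : ℝ≥0∞) [Fact (1 ≤ p)] : ContainsGrids (IsLpTSP p) := by
  intro m w _
  let V := {p : ℤ × ℤ // p ∈ (boundaryList m w).toFinset}
  let pos : V → ℤ × ℤ := Subtype.val
  have hinj : Function.Injective pos := Subtype.val_injective
  let I : TSPInstance :=
    { City := V
      cost := pointCost p (latticePoint p pos)
      cost_nonneg := fun e => by
        induction e with | _ a b
        exact dist_nonneg (x := latticePoint p pos a) (y := latticePoint p pos b) }
  have hI : IsLpTSP p I := ⟨latticePoint p pos, latticePoint_injective p hinj, rfl⟩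
  exact ⟨I, pos, hI, hI.isMetricTSP, hinj,
    fun p => ⟨fun ⟨v, hv⟩ => hv ▸ List.mem_toFinset.1 v.2,
      fun h => ⟨⟨p, List.mem_toFinset.2 h⟩, rfl⟩⟩, isAxisCost_pointCost p pos⟩

lemma two_ninths_logb (k : ℕ) : 2 / 9 * Real.logb 3 (3 ^ (k + 2) : ℝ) = 2 / 9 * (k + 2) := by
  rw [Real.logb_pow, Real.logb_self_eq_one (by norm_num)]
  push_cast; ring

/-- The left side is `(2 * k + 4) * 3 ^ k` minus a nonnegative term, so there is a slack of `4 * 3 ^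
k` to absorb the `1`. -/
lemma two_ninths_logb_mul_le {k : ℕ} :
    2 / 9 * ((k : ℝ) + 2) * (3 ^ (k + 2) - 1) ≤ (2 * (k : ℝ) + 8) * 3 ^ k - 1 := by
  have h1 : (1 : ℝ) ≤ 3 ^ k := one_le_pow₀ (by norm_num)
  have h2 : (0 : ℝ) ≤ k := k.cast_nonneg
  rw [pow_add]
  nlinarith

lemma ContainsGrids.le_greedyRatio_grid {C : TSPInstance → Prop} (hC : ContainsGrids C) {k n : ℕ}
    (hn : n = 3 ^ (k + 2) - 1) :
    ENNReal.ofReal (2 / 9 * Real.logb 3 ((n : ℝ) + 1)) ≤ greedyRatio C n := by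
  have hw := two_mul_gridWidth k
  have hw4 := four_le_gridWidth k
  obtain ⟨I, pos, hI, -, hpos, hr, hc⟩ := hC 0 (gridWidth k) (by omega)
  obtain ⟨S, hS, hSl⟩ := hc.exists_tour_of_grid hpos (by omega) hr
  obtain ⟨-, -, -, -, -, -, T, hT, -, hTl⟩ := hc.exists_greedyTour hpos hr
  have hcard := card_of_range_eq_boundaryList hpos hr
  have hn' : (n : ℝ) + 1 = 3 ^ (k + 2) := by
    have : n + 1 = 3 ^ (k + 2) := by omega
    exact_mod_cast this
  have hSn : edgeLength I.cost S = 3 ^ (k + 2) - 1 := by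
    have hw' : 2 * (gridWidth k : ℝ) + 1 = 3 ^ (k + 2) := by exact_mod_cast hw
    rw [hSl]; linarith
  have hT' := (le_pathLength_tailedPath 0 k).trans hTl.le
  have h1 : (1 : ℝ) ≤ 3 ^ k := one_le_pow₀ (by norm_num)
  rw [hn', two_ninths_logb]
  refine le_greedyRatio hI (by omega) hT hS (by positivity) (by nlinarith [k.cast_nonneg (α := ℝ)])
    ?_
  rw [hSn]
  exact two_ninths_logb_mul_le.trans hT'

lemma ContainsGrids.log_le_greedyRatio {C : TSPInstance → Prop} (hC : ContainsGrids C) {n : ℕ}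
    (hn : 3 ≤ n) : ENNReal.ofReal (1 / 54 * Real.log n) ≤ greedyRatio C n := by
  have hlog : 0 ≤ Real.log n := Real.log_natCast_nonneg n
  have hn0 : (0 : ℝ) < n := by exact_mod_cast (by omega : 0 < n)
  rcases Nat.lt_or_ge n 8 with h8 | h8
  -- Fewer than `8` cities do not hold even the smallest grid; a single row and the trivial ratio
  -- `1` suffice.
  · obtain ⟨I, pos, hI, -, hpos, hr, hc⟩ := hC n 0 (by omega)
    obtain ⟨T, hT⟩ := hc.exists_greedyTour_of_row hpos hn hr
    have hcard := card_of_range_eq_boundaryList hpos hr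
    have hle := hT.2.card_le_edgeLength hc hpos
    have h1 : (Fintype.card I.City : ℝ) = n := by rw [hcard]; simp
    rw [h1] at hle
    have h2 := Real.log_le_sub_one_of_pos hn0
    have h3 : (n : ℝ) ≤ 8 := by exact_mod_cast h8.le
    exact le_greedyRatio hI (by omega) hT hT.2 (by positivity) (by linarith) (by nlinarith)
  · obtain ⟨k, hk⟩ : ∃ k, Nat.log 3 (n + 1) = k + 2 := by
      have : 2 ≤ Nat.log 3 (n + 1) := Nat.le_log_of_pow_le (by norm_num) (by omega)
      exact ⟨Nat.log 3 (n + 1) - 2, by omega⟩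
    have hlow : 3 ^ (k + 2) ≤ n + 1 := hk ▸ Nat.pow_log_le_self 3 (by omega)
    have hhigh : n + 1 < 3 ^ (k + 3) := by
      have := Nat.lt_pow_succ_log_self (b := 3) (by norm_num) (n + 1)
      rwa [hk] at this
    have hw := two_mul_gridWidth k
    have hw4 := four_le_gridWidth k
    -- The largest grid that fits, with the remaining cities as a tail. Less than a factor `3` is
    -- lost in size, so `n ≤ 27 * 3 ^ k`.
    obtain ⟨I, pos, hI, hmet, hpos, hr, hc⟩ := hC (n + 1 - 3 ^ (k + 2)) (gridWidth k) (by omega)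
    obtain ⟨S, hS, hSl⟩ := hc.exists_tour_le hpos I.cost_nonneg hmet (by omega) hr
    obtain ⟨-, -, -, -, -, -, T, hT, -, hTl⟩ := hc.exists_greedyTour hpos hr
    have hcard := card_of_range_eq_boundaryList hpos hr
    rw [show n + 1 - 3 ^ (k + 2) + 2 * gridWidth k = n by omega] at hSl hcard
    have hT' := (le_pathLength_tailedPath _ k).trans hTl.le
    have h1 : (1 : ℝ) ≤ 3 ^ k := one_le_pow₀ (by norm_num)
    have h0 := k.cast_nonneg (α := ℝ)
    have hn27 : (n : ℝ) ≤ 27 * 3 ^ k := by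
      have : n ≤ 27 * 3 ^ k := by rw [pow_add] at hhigh; omega
      exact_mod_cast this
    have hlogn : Real.log n ≤ 2 * (k + 3) := by
      have h2 : Real.log n ≤ Real.log (3 ^ (k + 3)) := by
        refine Real.log_le_log hn0 ?_
        rw [pow_add]; linarith
      rw [Real.log_pow] at h2
      have h3 := Real.log_le_sub_one_of_pos (show (0 : ℝ) < 3 by norm_num)
      push_cast at h2
      nlinarith
    refine le_greedyRatio hI hcard hT hS (by positivity) (by nlinarith) ?_
    -- The constant `54` is `2 * 27`: the comparison tour has length at most `2 * n ≤ 54 * 3 ^ k`.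
    -- Together with `log n ≤ 2 * (k + 3)`, which uses `log 3 ≤ 2`, this leaves `(2 * k + 6) * 3 ^
    -- k`.
    calc 1 / 54 * Real.log n * edgeLength I.cost S
        ≤ 1 / 54 * (2 * (k + 3)) * (2 * (27 * 3 ^ k)) := by
          refine mul_le_mul (by gcongr) (by linarith) ?_ (by positivity)
          exact Finset.sum_nonneg fun e _ => I.cost_nonneg e
      _ ≤ (2 * (k : ℝ) + 8) * 3 ^ k - 1 := by nlinarith
      _ ≤ _ := hT'

lemma ContainsGrids.isThetaLog {C : TSPInstance → Prop} (hC : ContainsGrids C)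
    (hmet : ∀ I, C I → IsMetricTSP I) : IsThetaLog (greedyRatio C) :=
  ⟨1 / 54, 3, by norm_num, by norm_num, fun n hn => ⟨hC.log_le_greedyRatio hn,
    (greedyRatio_mono hmet n).trans (greedyRatio_metric_le n hn)⟩⟩

end LowerBounds

/-! ### The concrete grid instances and the main theorem -/

section GridInstances

/-- The coordinates of the cities of the `k`-th grid instance. -/
def gridPos (k : ℕ) (u : GridCity k) : ℤ × ℤ := ((u.1 : ℕ), (u.2 : ℕ))

lemma gridPos_injective (k : ℕ) : Function.Injective (gridPos k) := by
  intro u v h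
  simp only [gridPos, Prod.mk.injEq, Nat.cast_inj] at h
  exact Prod.ext (Fin.ext h.1) (Fin.ext h.2)

/-- The lower bound by the x-difference is demanded only for diagonal pairs on one side and for all
pairs on the other; for pairs sharing a coordinate it follows from the exact lengths. -/
lemma isGridInstance_iff {k : ℕ} {c : Sym2 (GridCity k) → ℝ} :
    IsGridInstance k c ↔ IsAxisCost (gridPos k) c := by
  constructor
  · intro h
    have hx : ∀ u v, u ≠ v → (gridPos k u).2 = (gridPos k v).2 →
        c s(u, v) = (|(gridPos k u).1 - (gridPos k v).1| : ℤ) := fun u v huv huv' => by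
      rw [h.same_y u v huv (Fin.ext (by simpa [gridPos] using huv'))]
      simp [gridPos]
    refine ⟨fun u v huv huv' => ?_, hx, fun u v huv => ?_⟩
    · rw [h.same_x u v huv (Fin.ext (by simpa [gridPos] using huv'))]
      simp [gridPos]
    · by_cases h2 : u.2 = v.2
      · exact (hx u v huv (by simp [gridPos, h2])).ge
      by_cases h1 : u.1 = v.1
      · rw [h.same_x u v huv h1]
        simp [gridPos, h1]
      · simpa [gridPos] using h.diag u v h1 h2
  · intro h
    refine ⟨fun u v huv huv' => ?_, fun u v huv huv' => ?_, fun u v h1 h2 => ?_⟩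
    · rw [h.same_x u v huv (by simp [gridPos, huv'])]
      simp [gridPos]
    · rw [h.same_y u v huv (by simp [gridPos, huv'])]
      simp [gridPos]
    · simpa [gridPos] using h.le u v (fun e => h1 (by rw [e]))

lemma IsAxisCost.translate {V : Type} {pos : V → ℤ × ℤ} {c : Sym2 V → ℝ} (h : IsAxisCost pos c)
    (a : ℤ) : IsAxisCost (fun u => ((pos u).1 + a, (pos u).2)) c :=
  ⟨fun u v huv e => h.same_x u v huv (by simpa using e),
    fun u v huv e => by simpa using h.same_y u v huv e,
    fun u v huv => by simpa using h.le u v huv⟩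

lemma isGridInstance_graphCost (k : ℕ) : IsGridInstance k (graphCost (gridGraph k)) := by
  rw [isGridInstance_iff]
  have hw4 := four_le_gridWidth k
  have : Nonempty (GridCity k) := ⟨(⟨0, by change 0 < gridWidth k; omega⟩, 0)⟩
  refine (isAxisCost_graphCost (fun u v => ?_) (gridPos_injective k) (fun u => ?_)
    (fun u v x huv h1 h2 => ?_) (fun u => ⟨(u.1, 0), rfl⟩)).2
  · simp only [gridGraph, SimpleGraph.boxProd_adj, SimpleGraph.pathGraph_adj, gridPos]
    rw [Fin.ext_iff, Fin.ext_iff]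
    generalize (u.1 : ℕ) = a, (u.2 : ℕ) = b, (v.1 : ℕ) = a', (v.2 : ℕ) = b'
    rcases abs_cases ((a : ℤ) - a') with h1 | h1 <;>
      rcases abs_cases ((b : ℤ) - b') with h2 | h2 <;> omega
  · have := u.2.2
    simp only [gridPos]
    omega
  · have hv := v.1.2
    simp only [gridPos] at h1 h2
    exact ⟨(⟨x.toNat, by omega⟩, u.2), by simp only [gridPos]; exact Prod.ext (by simp; omega) rfl⟩

lemma isGridInstance_pointCost (p : ℝ≥0∞) [Fact (1 ≤ p)] (k : ℕ) :
    IsGridInstance k (pointCost p (gridPoint p k)) := by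
  rw [isGridInstance_iff]
  have : gridPoint p k = latticePoint p (gridPos k) := by
    funext u
    simp [gridPoint, latticePoint, gridPos]
  rw [this]
  exact isAxisCost_pointCost p _

lemma range_gridPos (k : ℕ) (p : ℤ × ℤ) :
    p ∈ Set.range (fun u => ((gridPos k u).1 + 1, (gridPos k u).2)) ↔
      p ∈ boundaryList 0 (gridWidth k) := by
  rw [mem_boundaryList]
  constructor
  · rintro ⟨u, rfl⟩
    have h1 := u.1.2
    have h2 := u.2.2
    simp only [gridPos, gridWidth]
    omega
  · intro h
    refine ⟨(⟨(p.1 - 1).toNat, by change _ < gridWidth k; omega⟩, ⟨p.2.toNat, by omega⟩),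
      Prod.ext ?_ ?_⟩ <;> simp only [gridPos] <;> omega

end GridInstances

theorem theorem1 :
    -- the approximation ratio is of order `log n` on each of the classes
    (IsThetaLog (greedyRatio IsMetricTSP) ∧
      IsThetaLog (greedyRatio IsGraphicTSP) ∧
      IsThetaLog (greedyRatio IsEuclideanTSP) ∧
      IsThetaLog (greedyRatio IsRectilinearTSP) ∧
      ∀ (p : ℝ≥0∞) [Fact (1 ≤ p)], IsThetaLog (greedyRatio (IsLpTSP p))) ∧
    -- the grid instances
    (∀ k n : ℕ, n = 3 ^ (k + 2) - 1 →
      Fintype.card (GridCity k) = n ∧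
      IsGridInstance k (graphCost (gridGraph k)) ∧
      (∀ (p : ℝ≥0∞) [Fact (1 ≤ p)], IsGridInstance k (pointCost p (gridPoint p k))) ∧
      ∀ c : Sym2 (GridCity k) → ℝ, IsGridInstance k c →
        IsLeast {L : ℝ | ∃ T : Finset (Sym2 (GridCity k)), IsTour T ∧ L = edgeLength c T} n ∧
        (∃ (u v : GridCity k) (P : (⊤ : SimpleGraph (GridCity k)).Walk u v),
          IsPartialGreedyTour c P Set.univ ∧
          (P.edges.map c).sum = (2 * (k : ℝ) + 8) * 3 ^ k - 1) ∧
        ∃ T : Finset (Sym2 (GridCity k)), IsGreedyTour c T ∧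
          ((2 * (k : ℝ) + 8) * 3 ^ k - 1) / n < edgeLength c T / n ∧
          2 / 9 * Real.logb 3 ((n : ℝ) + 1) ≤ edgeLength c T / n) ∧
    -- the resulting explicit lower bound on the approximation ratio
    (∀ k n : ℕ, n = 3 ^ (k + 2) - 1 →
      ENNReal.ofReal (2 / 9 * Real.logb 3 ((n : ℝ) + 1)) ≤ greedyRatio IsGraphicTSP n ∧
      ENNReal.ofReal (2 / 9 * Real.logb 3 ((n : ℝ) + 1)) ≤ greedyRatio IsEuclideanTSP n ∧
      ENNReal.ofReal (2 / 9 * Real.logb 3 ((n : ℝ) + 1)) ≤ greedyRatio IsRectilinearTSP n ∧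
      ∀ (p : ℝ≥0∞) [Fact (1 ≤ p)],
        ENNReal.ofReal (2 / 9 * Real.logb 3 ((n : ℝ) + 1)) ≤ greedyRatio (IsLpTSP p) n) := by
  refine ⟨⟨?_, ?_, ?_, ?_, ?_⟩, ?_, ?_⟩
  · exact (containsGrids_graphic.mono fun _ h => h.isMetricTSP).isThetaLog fun _ h => h
  · exact containsGrids_graphic.isThetaLog fun _ h => h.isMetricTSP
  · exact (containsGrids_Lp 2).isThetaLog fun _ h => IsLpTSP.isMetricTSP h
  · exact (containsGrids_Lp 1).isThetaLog fun _ h => IsLpTSP.isMetricTSP h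
  · exact fun p _ => (containsGrids_Lp p).isThetaLog fun _ h => h.isMetricTSP
  · intro k n hn
    have hw := two_mul_gridWidth k
    have hw4 := four_le_gridWidth k
    have hn2 : n = 2 * gridWidth k := by omega
    have hn' : (n : ℝ) + 1 = 3 ^ (k + 2) := by
      have : n + 1 = 3 ^ (k + 2) := by omega
      exact_mod_cast this
    have hcard : Fintype.card (GridCity k) = n := by
      rw [Fintype.card_prod, Fintype.card_fin, Fintype.card_fin, hn2]
      ring
    refine ⟨hcard, isGridInstance_graphCost k, fun p _ => isGridInstance_pointCost p k,
      fun c hc => ?_⟩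
    -- The columns of `GridCity` start at `0`, those of `gridPath` at `1`, where the long edges fall
    -- on multiples of powers of three.
    have hc' := (isGridInstance_iff.1 hc).translate 1
    have hpos : Function.Injective fun u : GridCity k => ((gridPos k u).1 + 1, (gridPos k u).2) :=
      fun u v h => gridPos_injective k (by
        simp only [Prod.mk.injEq, add_left_inj] at h
        exact Prod.ext h.1 h.2)
    obtain ⟨u, v, P, hP, hsup, hlen, T, hT, hPT, hTl⟩ := hc'.exists_greedyTour hpos
      (range_gridPos k)
    have htail : tailedPath 0 k = gridPath k := by simp [tailedPath, rowList]
    rw [htail, pathLength_gridPath] at hlen hTl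
    have hn0 : (0 : ℝ) < n := by
      have : 0 < n := by omega
      exact_mod_cast this
    refine ⟨⟨?_, ?_⟩, ⟨u, v, P, ⟨hP, Set.eq_univ_of_forall hsup, T, hT, hPT⟩, hlen⟩, T, hT,
      div_lt_div_of_pos_right hTl hn0, ?_⟩
    · obtain ⟨S, hS, hSl⟩ := hc'.exists_tour_of_grid hpos (by omega) (range_gridPos k)
      exact ⟨S, hS, by rw [hSl, hn2]; push_cast; rfl⟩
    · rintro _ ⟨S, hS, rfl⟩
      exact hcard ▸ hS.card_le_edgeLength hc' hpos
    · rw [le_div_iff₀ hn0, hn', two_ninths_logb, eq_sub_of_add_eq hn']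
      exact two_ninths_logb_mul_le.trans hTl.le
  · exact fun k n hn => ⟨containsGrids_graphic.le_greedyRatio_grid hn,
      (containsGrids_Lp 2).le_greedyRatio_grid hn, (containsGrids_Lp 1).le_greedyRatio_grid hn,
      fun p _ => (containsGrids_Lp p).le_greedyRatio_grid hn⟩
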